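/- Let $A$ be a unital C*-algebra, let $\mathcal C(A)$ be the poset of its unital commutative C*-subalgebras (containing the unit of $A$) ordered by inclusion, with least element $\mathbb C\cdot 1$, let $\mathcal T(A)=\mathbf{Sets}^{\mathcal C(A)}$, and let $\underline A\colon C\mapsto C$ be the tautological internal commutative C*-algebra. For $C\in\mathcal C(A)$ let $L_C$ be the distributive lattice (with top and bottom) freely generated by symbols $D_c$, $c\in C_{\mathrm{sa}}$, subject to $$D_1=\top,\quad D_a\wedge D_{-a}=\bot,\quad D_{-b^2}=\bot,\quad D_{a+b}\le D_a\vee D_b,\quad D_{ab}=(D_a\wedge D_b)\vee(D_{-a}\wedge D_{-b}),$$ and for $C\subseteq D$ let $L_C\to L_D$ be the map $D_c\mapsto D_c$. Write $x\ll y$ in $L_C$ if $x\wedge z=\bot$ and $y\vee z=\top$ for some $z$. A regular ideal of $L_C$ is an ideal $I$ (with $\bot\in I$) such that $x\in I$ whenever every $y\ll x$ lies in $I$. Let $f(x)=\{c\mid \forall b\ll c,\ b\le x\}$, and for $V\subseteq L_C$ write $x\vartriangleleft_C V$ if every regular ideal containing all $f(v)$, $v\in V$, contains $f(x)$ (that is,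 $f(x)\le\bigvee f(V)$ in the frame of regular ideals). The Gelfand spectrum $\mathcal O(\underline\Sigma)$ of $\underline A$ is the internal frame in $\mathcal T(A)$ freely generated by symbols indexed by $\underline A_{\mathrm{sa}}$, subject to the five relations above and the regularity rule $D_a\le\bigvee_{r\in\mathbb Q,\,r>0}D_{a-r}$, all interpreted in $\mathcal T(A)$. **Theorem.** The functor $\underline L\colon C\mapsto L_C$ is the internal distributive lattice in $\mathcal T(A)$ freely generated by symbols indexed by $\underline A_{\mathrm{sa}}$ subject to the five relations; every element of $L_C$ is of the form $D_c$; the maps $L_C\to L_D$ are injective, so that one may regard $L_C\subseteq L_D$; and $D_c\vartriangleleft_C V$ if and only if for every rational $q>0$ there is a finite (possibly empty) $V_0\subseteq V$ with $D_{c-q}\le\bigvee V_0$. The spectrum $\mathcal O(\underline\Sigma)$ exists, and up to an isomorphism of internal frames, under which the generator $D_c$ at $C$ corresponds to $D\mapsto\{x\in L_D\mid x\vartriangleleft_D\{D_c\}\}$, it is computed as follows. 1. At $C$, the set $\mathcal O(\underline\Sigma)(C)$, ordered by inclusion, consists of those subfunctors $\underline U$ of $\underline L_{|\uparrow C}$ such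 that for all $D\supseteq C$ and all $D_d\in L_D$ one has $D_d\vartriangleleft_D\underline U(D)\Rightarrow D_d\in\underline U(D)$. Equivalently, each $\underline U(D)$, $D\supseteq C$, is a regular ideal of $L_D$. 2. In particular, $\mathcal O(\underline\Sigma)(\mathbb C\cdot 1)$ consists of those subfunctors $\underline U$ of $\underline L$ such that for all $C\in\mathcal C(A)$ and all $D_c\in L_C$ one has $D_c\vartriangleleft_C\underline U(C)\Rightarrow D_c\in\underline U(C)$. 3. A family $\{\underline U(C)\subseteq L_C\}_{C\in\mathcal C(A)}$ is a subfunctor of $\underline L$ if and only if $\underline U(C)\subseteq\underline U(D)$ (as subsets of $L_D$) whenever $C\subseteq D$. 4. For $C\subseteq D$ the map $\mathcal O(\underline\Sigma)(C)\to\mathcal O(\underline\Sigma)(D)$ truncates $\underline U\colon{\uparrow}C\to\mathbf{Sets}$ to ${\uparrow}D$. 5. Let $\mathcal O(\mathcal C(A))$ be the frame of upper sets of $\mathcal C(A)$, and for an upper set $V$ let $\mathcal O(\overline\Sigma)(V)$ be the poset of compatible families $(s_C\in\mathcal O(\underline\Sigma)(C))_{C\in V}$. The external description of $\mathcal O(\underline\Sigma)$,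 i.e. the map $\pi_\Sigma^*\colon\mathcal O(\mathcal C(A))\to\mathcal O(\underline\Sigma)(\mathbb C\cdot 1)$ sending $V$ to the image of $\top$ under the left adjoint of the restriction $\mathcal O(\underline\Sigma)(\mathbb C\cdot 1)\to\mathcal O(\overline\Sigma)(V)$, exists and is a frame map, and on basic opens it is $\pi_\Sigma^*({\uparrow}D)=\chi_{\uparrow D}$, where $\chi_{\uparrow D}(E)=L_E$ if $E\supseteq D$ and $\chi_{\uparrow D}(E)=\{\bot\}$ if $E\not\supseteq D$ ($L_E$ and $\{\bot\}$ being the largest and the smallest regular ideal of $L_E$). -/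

import Mathlib

open CategoryTheory TopologicalSpace

universe u

namespace Bohrification

/-! ### The lattice freely generated by the symbols `D a` -/

/-- The relations `D 1 = ⊤`, `D a ⊓ D (-a) = ⊥`, `D (-b²) = ⊥`, `D (a + b) ≤ D a ⊔ D b` and
`D (a b) = (D a ⊓ D b) ⊔ (D (-a) ⊓ D (-b))` for a map from a commutative ring `R` (in the
application, the self-adjoint part of a commutative C*-algebra) to a distributive lattice. -/
structure SpectralRelations {R L : Type*} [CommRing R] [DistribLattice L] [BoundedOrder L]
    (D : R → L) : Prop where
  map_one : D 1 = ⊤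
  map_inf_neg : ∀ a, D a ⊓ D (-a) = ⊥
  map_neg_sq : ∀ b, D (-(b * b)) = ⊥
  map_add : ∀ a b, D (a + b) ≤ D a ⊔ D b
  map_mul : ∀ a b, D (a * b) = (D a ⊓ D b) ⊔ (D (-a) ⊓ D (-b))

/-- Formal lattice expressions in the symbols `D a`, `a ∈ R`. -/
inductive LatticeTerm (R : Type u) : Type u
  | gen (a : R) : LatticeTerm R
  | top : LatticeTerm R
  | bot : LatticeTerm R
  | inf (x y : LatticeTerm R) : LatticeTerm R
  | sup (x y : LatticeTerm R) : LatticeTerm R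

open LatticeTerm in
/-- The inequalities between formal expressions that follow from the axioms of bounded distributive
lattices and the spectral relations. -/
inductive LatticeTerm.Le {R : Type u} [CommRing R] : LatticeTerm R → LatticeTerm R → Prop
  | refl (x) : Le x x
  | trans {x y z} : Le x y → Le y z → Le x z
  | le_top (x) : Le x top
  | bot_le (x) : Le bot x
  | inf_le_left (x y) : Le (inf x y) x
  | inf_le_right (x y) : Le (inf x y) y
  | le_inf {x y z} : Le x y → Le x z → Le x (inf y z)
  | le_sup_left (x y) : Le x (sup x y)
  | le_sup_right (x y) : Le y (sup x y)
  | sup_le {x y z} : Le x z → Le y z → Le (sup x y) z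
  | distrib (x y z) : Le (inf x (sup y z)) (sup (inf x y) (inf x z))
  | top_le_one : Le top (gen 1)
  | inf_neg_le (a) : Le (inf (gen a) (gen (-a))) bot
  | neg_sq_le (b) : Le (gen (-(b * b))) bot
  | add_le (a b) : Le (gen (a + b)) (sup (gen a) (gen b))
  | mul_le (a b) :
      Le (gen (a * b)) (sup (inf (gen a) (gen b)) (inf (gen (-a)) (gen (-b))))
  | le_mul (a b) :
      Le (sup (inf (gen a) (gen b)) (inf (gen (-a)) (gen (-b)))) (gen (a * b))

/-- Provable inequality as a preorder. -/
instance LatticeTerm.instPreorder (R : Type u) [CommRing R] : Preorder (LatticeTerm R) where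
  le := LatticeTerm.Le
  le_refl := LatticeTerm.Le.refl
  le_trans _ _ _ := LatticeTerm.Le.trans

/-- The distributive lattice freely generated by the symbols `D a`, `a ∈ R`, subject to the
spectral relations. -/
def SpecLattice (R : Type u) [CommRing R] : Type u :=
  Antisymmetrization (LatticeTerm R) (· ≤ ·)

namespace SpecLattice

variable {R : Type u} [CommRing R]

/-- The class of a formal expression. -/
def mk (x : LatticeTerm R) : SpecLattice R := toAntisymmetrization (· ≤ ·) x

instance : PartialOrder (SpecLattice R) :=
  inferInstanceAs (PartialOrder (Antisymmetrization (LatticeTerm R) (· ≤ ·)))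

theorem mk_le_mk {x y : LatticeTerm R} : mk x ≤ mk y ↔ LatticeTerm.Le x y := Iff.rfl

theorem mk_surjective : Function.Surjective (mk : LatticeTerm R → SpecLattice R) := fun x =>
  Quotient.inductionOn' x fun t => ⟨t, rfl⟩

theorem mk_eq {x y : LatticeTerm R} (h : LatticeTerm.Le x y) (h' : LatticeTerm.Le y x) :
    mk x = mk y := le_antisymm (mk_le_mk.2 h) (mk_le_mk.2 h')

instance : Lattice (SpecLattice R) where
  sup := Quotient.map₂ LatticeTerm.sup fun _ _ h _ _ k =>
    ⟨.sup_le (h.1.trans (.le_sup_left _ _)) (k.1.trans (.le_sup_right _ _)),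
      .sup_le (h.2.trans (.le_sup_left _ _)) (k.2.trans (.le_sup_right _ _))⟩
  inf := Quotient.map₂ LatticeTerm.inf fun _ _ h _ _ k =>
    ⟨.le_inf (.trans (.inf_le_left _ _) h.1) (.trans (.inf_le_right _ _) k.1),
      .le_inf (.trans (.inf_le_left _ _) h.2) (.trans (.inf_le_right _ _) k.2)⟩
  le_sup_left x y := by
    induction x, y using Quotient.inductionOn₂ with | _ x y => exact .le_sup_left x y
  le_sup_right x y := by
    induction x, y using Quotient.inductionOn₂ with | _ x y => exact .le_sup_right x y
  sup_le x y z := by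
    induction x, y, z using Quotient.inductionOn₃ with
      | _ x y z => exact LatticeTerm.Le.sup_le (x := x) (y := y) (z := z)
  inf_le_left x y := by
    induction x, y using Quotient.inductionOn₂ with | _ x y => exact .inf_le_left x y
  inf_le_right x y := by
    induction x, y using Quotient.inductionOn₂ with | _ x y => exact .inf_le_right x y
  le_inf x y z := by
    induction x, y, z using Quotient.inductionOn₃ with
      | _ x y z => exact LatticeTerm.Le.le_inf (x := x) (y := y) (z := z)

instance : DistribLattice (SpecLattice R) :=
  DistribLattice.ofInfSupLe fun x y z => by
    induction x, y, z using Quotient.inductionOn₃ with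
      | _ x y z => exact LatticeTerm.Le.distrib x y z

instance : BoundedOrder (SpecLattice R) where
  top := mk .top
  bot := mk .bot
  le_top x := by obtain ⟨t, rfl⟩ := mk_surjective x; exact .le_top t
  bot_le x := by obtain ⟨t, rfl⟩ := mk_surjective x; exact .bot_le t

/-- The generator `D a`. -/
def D (a : R) : SpecLattice R := mk (.gen a)

theorem spectralRelations_D : SpectralRelations (D : R → SpecLattice R) where
  map_one := mk_eq (.le_top _) .top_le_one
  map_inf_neg a := mk_eq (.inf_neg_le a) (.bot_le _)
  map_neg_sq b := mk_eq (.neg_sq_le b) (.bot_le _)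
  map_add a b := mk_le_mk.2 (.add_le a b)
  map_mul a b := mk_eq (.mul_le a b) (.le_mul a b)

section lift

variable {L : Type*} [DistribLattice L] [BoundedOrder L]

/-- The value of a formal expression under an assignment of the symbols. -/
def eval (g : R → L) : LatticeTerm R → L
  | .gen a => g a
  | .top => ⊤
  | .bot => ⊥
  | .inf x y => eval g x ⊓ eval g y
  | .sup x y => eval g x ⊔ eval g y

theorem eval_le {g : R → L} (hg : SpectralRelations g) {x y : LatticeTerm R}
    (h : LatticeTerm.Le x y) : eval g x ≤ eval g y := by
  induction h with
  | refl => exact le_rfl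
  | trans _ _ h k => exact h.trans k
  | le_top => exact le_top
  | bot_le => exact bot_le
  | inf_le_left => exact inf_le_left
  | inf_le_right => exact inf_le_right
  | le_inf _ _ h k => exact le_inf h k
  | le_sup_left => exact le_sup_left
  | le_sup_right => exact le_sup_right
  | sup_le _ _ h k => exact sup_le h k
  | distrib => exact inf_sup_left _ _ _ |>.le
  | top_le_one => exact hg.map_one.ge
  | inf_neg_le a => exact (hg.map_inf_neg a).le
  | neg_sq_le b => exact (hg.map_neg_sq b).le
  | add_le a b => exact hg.map_add a b
  | mul_le a b => exact (hg.map_mul a b).le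
  | le_mul a b => exact (hg.map_mul a b).ge

/-- The lattice homomorphism determined by an assignment satisfying the relations. -/
def lift (g : R → L) (hg : SpectralRelations g) : BoundedLatticeHom (SpecLattice R) L where
  toFun := Quotient.lift (eval g) fun _ _ h => le_antisymm (eval_le hg h.1) (eval_le hg h.2)
  map_sup' x y := by induction x, y using Quotient.inductionOn₂; rfl
  map_inf' x y := by induction x, y using Quotient.inductionOn₂; rfl
  map_top' := rfl
  map_bot' := rfl

@[simp]
theorem lift_D (g : R → L) (hg : SpectralRelations g) (a : R) : lift g hg (D a) = g a := rfl

/-- A bounded lattice homomorphism is determined by its values on the generators. -/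
theorem hom_ext {φ ψ : BoundedLatticeHom (SpecLattice R) L} (h : ∀ a, φ (D a) = ψ (D a)) :
    φ = ψ := by
  ext x
  obtain ⟨t, rfl⟩ := mk_surjective x
  induction t with
  | gen a => exact h a
  | top => exact (map_top φ).trans (map_top ψ).symm
  | bot => exact (map_bot φ).trans (map_bot ψ).symm
  | inf x y hx hy =>
    exact (map_inf φ (mk x) (mk y)).trans (by rw [hx, hy]; exact (map_inf ψ (mk x) (mk y)).symm)
  | sup x y hx hy =>
    exact (map_sup φ (mk x) (mk y)).trans (by rw [hx, hy]; exact (map_sup ψ (mk x) (mk y)).symm)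

end lift

/-- A ring homomorphism `f` induces `D a ↦ D (f a)`. -/
def map {S : Type u} [CommRing S] (f : R →+* S) :
    BoundedLatticeHom (SpecLattice R) (SpecLattice S) :=
  lift (fun a => D (f a))
    { map_one := by simpa using spectralRelations_D.map_one
      map_inf_neg := fun a => by simpa using spectralRelations_D.map_inf_neg (f a)
      map_neg_sq := fun b => by simpa using spectralRelations_D.map_neg_sq (f b)
      map_add := fun a b => by simpa using spectralRelations_D.map_add (f a) (f b)
      map_mul := fun a b => by simpa using spectralRelations_D.map_mul (f a) (f b) }

end SpecLattice

/-! ### Regular ideals and the covering relation -/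

section Cover

variable {L : Type*} [DistribLattice L] [BoundedOrder L]

/-- `x ≪ y` (`x` is well inside `y`): some `z` satisfies `x ⊓ z = ⊥` and `y ⊔ z = ⊤`. -/
def WellInside (x y : L) : Prop := ∃ z, x ⊓ z = ⊥ ∧ y ⊔ z = ⊤

/-- A subset of `L` is a regular ideal if it is an ideal and contains `x` as soon as it contains
all `y ≪ x`. -/
structure IsRegularIdeal (I : Set L) : Prop where
  bot_mem : ⊥ ∈ I
  lower : ∀ x y, x ∈ I → y ≤ x → y ∈ I
  sup_mem : ∀ x y, x ∈ I → y ∈ I → x ⊔ y ∈ I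
  regular : ∀ x, (∀ y, WellInside y x → y ∈ I) → x ∈ I

/-- The canonical map from `L` to sets of elements of `L` (for a normal lattice its values are
regular ideals): `f x = {c | ∀ b ≪ c, b ≤ x}`. -/
def canonicalMap (x : L) : Set L := {c | ∀ b, WellInside b c → b ≤ x}

/-- The covering relation `x ◁ V`, that is `f x ≤ ⋁ f(V)` in the frame of regular ideals ordered by
inclusion: every regular ideal that contains all `f v`, `v ∈ V`, contains `f x`. -/
def Covers (x : L) (V : Set L) : Prop :=
  ∀ I : Set L, IsRegularIdeal I → (∀ v ∈ V, canonicalMap v ⊆ I) → canonicalMap x ⊆ I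

end Cover

/-! ### Subobjects, frames and frame maps in the topos of functors on a poset -/

section Topos

variable {P : Type u} [PartialOrder P]

/-- The set-valued functor underlying a lattice-valued functor. -/
abbrev underlying (F : P ⥤ BddDistLat.{u}) : P ⥤ Type u := F ⋙ forget BddDistLat

/-- The restriction map `F C → F D` for `C ≤ D`. -/
def res (F : P ⥤ BddDistLat.{u}) {C D : P} (h : C ≤ D) : BoundedLatticeHom (F.obj C) (F.obj D) :=
  (F.map (homOfLE h)).hom

theorem res_trans (F : P ⥤ BddDistLat.{u}) {C D E : P} (h : C ≤ D) (k : D ≤ E) (x : F.obj C) :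
    res F (h.trans k) x = res F k (res F h x) := by
  have : F.map (homOfLE (h.trans k)) = F.map (homOfLE h) ≫ F.map (homOfLE k) := by
    rw [← F.map_comp]; rfl
  simp only [res, this]
  rfl

/-- The inclusion of the poset `↑C = {D | C ≤ D}` into `P`. -/
abbrev inclAbove (C : P) : Set.Ici C ⥤ P :=
  Monotone.functor (f := fun D : Set.Ici C => D.1) fun _ _ h => h

/-- The restriction of a functor to `↑C`. -/
abbrev above (F : P ⥤ Type u) (C : P) : Set.Ici C ⥤ Type u := inclAbove C ⋙ F

/-- `Sub (F|↑C)`, the value at `C` of the power object of `F`. -/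
abbrev SubAbove (F : P ⥤ Type u) (C : P) : Type u := Subfunctor (above F C)

/-- The value at `D ≥ C` of a subfunctor of `F|↑C`. -/
abbrev SubAbove.at {F : P ⥤ Type u} {C : P} (U : SubAbove F C) (D : P) (h : C ≤ D) :
    Set (F.obj D) :=
  U.obj ⟨D, h⟩

/-- Truncation of a subfunctor of `F|↑C` to `↑D`, for `C ≤ D`. -/
def SubAbove.truncate {F : P ⥤ Type u} {C D : P} (h : C ≤ D) (U : SubAbove F C) :
    SubAbove F D where
  obj E := U.at E.1 (h.trans E.2)
  map {E E'} i := U.map (U := ⟨E.1, h.trans E.2⟩) (V := ⟨E'.1, h.trans E'.2⟩) (homOfLE i.le)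

/-- `s ∈ F C` is the supremum of `U ∈ Sub (F|↑C)` in the internal sense: the formula
`∀ z, s ≤ z ↔ ∀ y ∈ U, y ≤ z` is forced at `C`. -/
def IsInternalSup (F : P ⥤ BddDistLat.{u}) {C : P} (U : SubAbove (underlying F) C)
    (s : F.obj C) : Prop :=
  ∀ (D : P) (hD : C ≤ D) (z : F.obj D), res F hD s ≤ z ↔
    ∀ (E : P) (hE : D ≤ E) (y : F.obj E), y ∈ U.at E (hD.trans hE) → y ≤ res F hE z

/-- The subfunctor `{x ⊓ y | y ∈ U}` of `F|↑C`, for `x ∈ F C`. -/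
def infSub (F : P ⥤ BddDistLat.{u}) {C : P} (x : F.obj C) (U : SubAbove (underlying F) C) :
    SubAbove (underlying F) C where
  obj D := {w : F.obj D.1 | ∃ y : F.obj D.1, y ∈ U.at D.1 D.2 ∧ w = res F D.2 x ⊓ y}
  map {D E} i := by
    rintro w ⟨y, hy, rfl⟩
    refine ⟨res F i.le y, U.map i hy, ?_⟩
    rw [res_trans F D.2 i.le x]
    exact map_inf (res F i.le) _ _

/-- An internal frame in `Sets^P`: an internal bounded distributive lattice, that is a functor from
`P` to bounded distributive lattices, in which internally every subobject has a supremum and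
`x ⊓ ⋁ U = ⋁ {x ⊓ y | y ∈ U}`. -/
structure IsInternalFrame (F : P ⥤ BddDistLat.{u}) : Prop where
  exists_sup : ∀ (C : P) (U : SubAbove (underlying F) C), ∃ s, IsInternalSup F U s
  inf_sup : ∀ (C : P) (x s : F.obj C) (U : SubAbove (underlying F) C),
    IsInternalSup F U s → IsInternalSup F (infSub F x U) (x ⊓ s)

/-- The image of `U ∈ Sub (F|↑C)` under a natural transformation. -/
abbrev imageSub {F G : P ⥤ BddDistLat.{u}} (φ : F ⟶ G) {C : P} (U : SubAbove (underlying F) C) :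
    SubAbove (underlying G) C :=
  U.image (Functor.whiskerLeft (inclAbove C) (Functor.whiskerRight φ (forget BddDistLat)))

/-- An internal frame map: a natural transformation of internal lattices (preserving finite meets
and joins) that preserves all internal suprema. -/
def IsInternalFrameMap {F G : P ⥤ BddDistLat.{u}} (φ : F ⟶ G) : Prop :=
  ∀ (C : P) (U : SubAbove (underlying F) C) (s : F.obj C),
    IsInternalSup F U s → IsInternalSup G (imageSub φ U) ((φ.app C).hom s)

/-- The opens of `P` in the Alexandrov topology, whose opens are the upper sets. -/
abbrev AlexandrovOpens (P : Type u) [PartialOrder P] : Type u :=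
  Opens (Topology.WithUpperSet P)

/-- The basic Alexandrov open `↑D`. -/
def upOpen (D : P) : AlexandrovOpens P where
  carrier := Topology.WithUpperSet.ofUpperSet ⁻¹' Set.Ici D
  is_open' := fun _ _ h hx => le_trans (α := P) hx h

/-- The value on the Alexandrov open `V` of the sheaf corresponding to the functor `F`: the
compatible families `(s C ∈ F C)` indexed by `C ∈ V`, ordered pointwise. -/
def Sections (F : P ⥤ BddDistLat.{u}) (V : AlexandrovOpens P) : Type u :=
  {s : ∀ C : {C : P // Topology.WithUpperSet.toUpperSet C ∈ V}, F.obj C.1 //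
    ∀ C D (h : C.1 ≤ D.1), res F h (s C) = s D}

instance (F : P ⥤ BddDistLat.{u}) (V : AlexandrovOpens P) : PartialOrder (Sections F V) :=
  PartialOrder.lift (fun s => s.1) Subtype.val_injective

/-- The top element of `Sections F V`. -/
def Sections.top (F : P ⥤ BddDistLat.{u}) (V : AlexandrovOpens P) : Sections F V :=
  ⟨fun _ => ⊤, fun _ _ h => map_top (res F h)⟩

/-- The restriction map from the value at the least element (the global sections) to the
sections over `V`. -/
def Sections.ofBot [OrderBot P] (F : P ⥤ BddDistLat.{u}) (V : AlexandrovOpens P)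
    (x : F.obj ⊥) : Sections F V :=
  ⟨fun _ => res F bot_le x, fun _ _ h => (res_trans F bot_le h x).symm⟩

/-- `π : 𝒪(P) → F ⊥` is the external description of the internal frame `F`: its value at `V` is
`l ⊤`, for the left adjoint `l` of the restriction map to the sections over `V`. -/
def IsExternalDescription [OrderBot P] (F : P ⥤ BddDistLat.{u})
    (π : AlexandrovOpens P → F.obj ⊥) : Prop :=
  ∀ V : AlexandrovOpens P, ∃ l : Sections F V → F.obj ⊥,
    GaloisConnection l (Sections.ofBot F V) ∧ π V = l (Sections.top F V)

end Topos

/-- A map between posets that preserves finite meets and arbitrary joins, in the sense that it takes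
them to greatest lower and least upper bounds. -/
structure IsFrameMap {X Y : Type*} [Order.Frame X] [DistribLattice Y] [BoundedOrder Y]
    (f : X → Y) : Prop where
  map_top : f ⊤ = ⊤
  map_inf : ∀ x y, f (x ⊓ y) = f x ⊓ f y
  map_sSup : ∀ S : Set X, IsLUB (f '' S) (f (sSup S))

/-! ### The Bohrification of a C*-algebra -/

section Bohr

variable {A : Type u} [CStarAlgebra A]

variable (A) in
/-- The poset `𝒞(A)` of unital commutative C*-subalgebras of `A`, ordered by inclusion. -/
def Context : Type u :=
  {C : StarSubalgebra ℂ A // IsClosed (C : Set A) ∧ ∀ x ∈ C, ∀ y ∈ C, x * y = y * x}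

instance : PartialOrder (Context A) := inferInstanceAs (PartialOrder (Subtype _))

/-- The least element `ℂ · 1`. -/
instance : OrderBot (Context A) where
  bot := ⟨⊥, by
    have : ((⊥ : StarSubalgebra ℂ A) : Set A) =
        ((LinearMap.range (Algebra.linearMap ℂ A) : Submodule ℂ A) : Set A) := by
      rw [StarSubalgebra.coe_bot]; rfl
    rw [this]
    exact Submodule.closed_of_finiteDimensional _, by
    rintro _ ⟨x, rfl⟩ y _
    exact Algebra.commutes x y⟩
  bot_le C := (bot_le : (⊥ : StarSubalgebra ℂ A) ≤ C.1)

noncomputable instance (C : Context A) : CommCStarAlgebra C.1 :=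
  { StarSubalgebra.cstarAlgebra C.1 (h_closed := C.2.1) with
    mul_comm := fun x y => Subtype.ext (C.2.2 x x.2 y y.2) }

/-- The self-adjoint part of `C`. -/
abbrev Context.Sa (C : Context A) : Type u := selfAdjoint C.1

/-- The inclusion of self-adjoint parts. -/
noncomputable def Context.incl {C D : Context A} (h : C ≤ D) : C.Sa →+* D.Sa where
  toFun a := ⟨⟨a.1.1, h a.1.2⟩, 
    Subtype.ext (show star a.1.1 = a.1.1 from congrArg Subtype.val (show star a.1 = a.1 from a.2))⟩
  map_one' := rfl
  map_mul' _ _ := rfl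
  map_zero' := rfl
  map_add' _ _ := rfl

variable (A) in
/-- The self-adjoint part of the Bohrification of `A`, the functor `C ↦ C_sa`. -/
noncomputable def bohrSa : Context A ⥤ Type u where
  obj C := C.Sa
  map i := ↾(Context.incl i.le)

variable (A) in
/-- The functor `C ↦ L_C`, with `L_C → L_D` given by `D_c ↦ D_c`. -/
noncomputable def specFunctor : Context A ⥤ BddDistLat.{u} where
  obj C := BddDistLat.of (SpecLattice C.Sa)
  map i := BddDistLat.ofHom (SpecLattice.map (Context.incl i.le))
  map_id C := by
    apply BddDistLat.hom_ext
    exact SpecLattice.hom_ext fun a => rfl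
  map_comp i j := by
    apply BddDistLat.hom_ext
    exact SpecLattice.hom_ext fun a => rfl

variable (A) in
/-- The family of generators `c ↦ D_c`, as an arrow of the topos. -/
noncomputable def specGen : bohrSa A ⟶ underlying (specFunctor A) where
  app C := ↾fun a : C.Sa => (SpecLattice.D a : SpecLattice C.Sa)
  naturality _ _ _ := rfl

/-- The value at `a ∈ C_sa` of an arrow from the self-adjoint part of the Bohrification to the
object underlying an internal lattice. -/
def val {F : Context A ⥤ BddDistLat.{u}} (g : bohrSa A ⟶ underlying F) {C : Context A}
    (a : C.Sa) : F.obj C :=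
  g.app C a

/-- The spectral relations hold internally for the arrow `g`. -/
def InternalRelations {F : Context A ⥤ BddDistLat.{u}} (g : bohrSa A ⟶ underlying F) : Prop :=
  ∀ C : Context A, SpectralRelations fun a : C.Sa => val g a

/-- The regularity rule `g a ≤ ⋁_{r ∈ ℚ, r > 0} g (a - r)` holds internally: `g a` lies below each
upper bound of the elements `g (a - r)`. -/
def InternalRegularity {F : Context A ⥤ BddDistLat.{u}} (g : bohrSa A ⟶ underlying F) : Prop :=
  ∀ (C : Context A) (a : C.Sa) (z : F.obj C),
    (∀ r : ℚ, 0 < r → val g (a - (r : ℝ) • (1 : C.Sa)) ≤ z) → val g a ≤ z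

/-- `(L, g)` is the internal bounded distributive lattice freely generated by symbols indexed by the
self-adjoint part of the Bohrification, subject to the spectral relations. -/
structure IsFreeInternalLattice (L : Context A ⥤ BddDistLat.{u})
    (g : bohrSa A ⟶ underlying L) : Prop where
  relations : InternalRelations g
  existsUnique : ∀ (M : Context A ⥤ BddDistLat.{u}) (k : bohrSa A ⟶ underlying M),
    InternalRelations k →
      ∃! φ : L ⟶ M, ∀ (C : Context A) (a : C.Sa), (φ.app C).hom (val g a) = val k a

/-- `(F, d)` is the internal Gelfand spectrum of the Bohrification of `A`: the internal frame
freely generated by symbols indexed by its self-adjoint part, subject to the spectral relations and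
the regularity rule. -/
structure IsInternalSpectrum (F : Context A ⥤ BddDistLat.{u})
    (d : bohrSa A ⟶ underlying F) : Prop where
  isFrame : IsInternalFrame F
  relations : InternalRelations d
  regularity : InternalRegularity d
  existsUnique : ∀ (G : Context A ⥤ BddDistLat.{u}) (g : bohrSa A ⟶ underlying G),
    IsInternalFrame G → InternalRelations g → InternalRegularity g →
      ∃! φ : F ⟶ G, IsInternalFrameMap φ ∧
        ∀ (C : Context A) (a : C.Sa), (φ.app C).hom (val d a) = val g a

/-- `U ∈ Sub (L|↑C)` is closed: for all `D ⊇ C` and `x ∈ L_D`, `x ◁ U(D)` implies `x ∈ U(D)`. -/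
def IsClosedSub {C : Context A} (U : SubAbove (underlying (specFunctor A)) C) : Prop :=
  ∀ (D : Context A) (h : C ≤ D) (x : SpecLattice D.Sa), Covers x (U.at D h) → x ∈ U.at D h

variable (A) in
/-- The poset of closed subfunctors of `L|↑C`, ordered by inclusion. -/
abbrev ClosedSub (C : Context A) : Type u :=
  {U : SubAbove (underlying (specFunctor A)) C // IsClosedSub U}

variable (A) in
/-- The poset of those subfunctors `U` of `L` such that for all `C` and `x ∈ L_C`, `x ◁ U(C)`
implies `x ∈ U(C)`, ordered by inclusion. -/
abbrev GlobalClosedSub : Type u :=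
  {U : Subfunctor (underlying (specFunctor A)) //
    ∀ (C : Context A) (x : SpecLattice C.Sa), Covers x (U.obj C) → x ∈ U.obj C}

end Bohr

end Bohrification

/-! By Gelfand duality `C_sa` is the ring of real continuous functions on a compact space. There
`D_a ∨ z = ⊤` survives a small shift to `D_{a-q} ∨ z = ⊤`, since a positive continuous function is
bounded away from zero, and `D_{a-q} ≪ D_a`. Hence each `L_C` is normal, and `x ≪ D_a` means `x ≤
D_{a-q}` for some `q > 0` (`wellInside_D_iff`). In a normal lattice the regular ideal generated by
`V` is explicit (`regularClosure`), and `x ◁ V` is membership in it (`covers_iff`).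

The maps `L_C → L_D` fix scalars, so whatever is well inside an image is bounded by the image of
something well inside. Generated regular ideals are therefore stable under restriction, and the
subfunctors with regular values form an internal frame (`isInternalFrame_regFunctor`). A lattice
transformation `φ` into an internal frame extends uniquely to it once `φ x` is below every upper
bound of the `φ y`, `y ≪ x`: the extension `U ↦ ⋁ φ(U)` is left adjoint to `z ↦ {x | φ x ≤ z}`. The
description of `≪` by shifts turns the regularity rule into this condition, so the frame is the
spectrum, and any other spectrum is isomorphic to it.

Injectivity of `L_C → L_D` rests on an algebraic criterion (`D_le_D_iff`): `D_a ≤ D_b` iff `(a⁺)^n ≤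
m b⁺` for some `n`, `m`. It comes from interpreting `D_a` as the basic open of `a⁺` in the prime
spectrum, and injective ring homomorphisms reflect it. The external description extends sections by
`{⊥}`, which is a regular ideal. -/

namespace Bohrification

/-! ### Regular ideals of normal lattices -/

section Normal

variable {L : Type*} [DistribLattice L] [BoundedOrder L]

theorem WellInside.le {x y : L} (h : WellInside x y) : x ≤ y := by
  obtain ⟨z, hx, hy⟩ := h
  calc x = x ⊓ (y ⊔ z) := by rw [hy, inf_top_eq]
    _ = x ⊓ y := by rw [inf_sup_left, hx, sup_bot_eq]
    _ ≤ y := inf_le_right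

theorem WellInside.trans_le {x y y' : L} (h : WellInside x y) (hy : y ≤ y') :
    WellInside x y' := by
  obtain ⟨z, hx, hz⟩ := h
  exact ⟨z, hx, top_le_iff.1 (hz.ge.trans (sup_le_sup_right hy z))⟩

theorem le_of_inf_eq_bot_of_sup_eq_top {x y z : L} (hx : x ⊓ z = ⊥) (hy : y ⊔ z = ⊤) : x ≤ y :=
  WellInside.le ⟨z, hx, hy⟩

variable (L) in
/-- A bounded distributive lattice is normal if `x ⊔ z = ⊤` implies `w ⊔ z = ⊤` for some `w`
well inside `x`. -/
def IsNormalLattice : Prop :=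
  ∀ x z : L, x ⊔ z = ⊤ → ∃ w, WellInside w x ∧ w ⊔ z = ⊤

/-- The `z` that witnesses `x ≪ y` still witnesses `x ≪ w` after `y` is shrunk to `w`. -/
theorem IsNormalLattice.exists_between (hL : IsNormalLattice L) {x y : L} (h : WellInside x y) :
    ∃ w, WellInside x w ∧ WellInside w y := by
  obtain ⟨z, hx, hy⟩ := h
  obtain ⟨w, hw, hwz⟩ := hL y z hy
  exact ⟨w, ⟨z, hx, hwz⟩, hw⟩

/-- Shrink `y` against `y' ⊔ z`, then `y'` against `w ⊔ z`; the same `z`, disjoint from `x`, gives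
the bound on `x`. -/
theorem IsNormalLattice.exists_of_wellInside_sup (hL : IsNormalLattice L) {x y y' : L}
    (h : WellInside x (y ⊔ y')) :
    ∃ w w', WellInside w y ∧ WellInside w' y' ∧ x ≤ w ⊔ w' := by
  obtain ⟨z, hx, hz⟩ := h
  obtain ⟨w, hw, hwz⟩ := hL y (y' ⊔ z) (by rw [← sup_assoc, hz])
  obtain ⟨w', hw', hwz'⟩ := hL y' (w ⊔ z) (by rw [← hwz]; ac_rfl)
  exact ⟨w, w', hw, hw', le_of_inf_eq_bot_of_sup_eq_top hx (by rw [← hwz']; ac_rfl)⟩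

theorem IsRegularIdeal.finset_sup_mem {I : Set L} (hI : IsRegularIdeal I) (V : Finset L)
    (hV : (V : Set L) ⊆ I) : V.sup id ∈ I :=
  Finset.sup_induction (p := (· ∈ I)) hI.bot_mem (fun _ hx _ hy => hI.sup_mem _ _ hx hy)
    fun _ hx => hV hx

theorem IsRegularIdeal.inter {I J : Set L} (hI : IsRegularIdeal I) (hJ : IsRegularIdeal J) :
    IsRegularIdeal (I ∩ J) where
  bot_mem := ⟨hI.bot_mem, hJ.bot_mem⟩
  lower x y hx h := ⟨hI.lower x y hx.1 h, hJ.lower x y hx.2 h⟩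
  sup_mem x y hx hy := ⟨hI.sup_mem x y hx.1 hy.1, hJ.sup_mem x y hx.2 hy.2⟩
  regular x h := ⟨hI.regular x fun y hy => (h y hy).1, hJ.regular x fun y hy => (h y hy).2⟩

theorem isRegularIdeal_univ : IsRegularIdeal (Set.univ : Set L) where
  bot_mem := trivial
  lower _ _ _ _ := trivial
  sup_mem _ _ _ _ := trivial
  regular _ _ := trivial

theorem mem_canonicalMap_self (x : L) : x ∈ canonicalMap x := fun _ h => h.le

/-- Regularity is exactly what recovers `c` from the `b ≪ c`; this lets `Covers` be tested on
elements instead of the sets `f x`. -/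
theorem IsRegularIdeal.canonicalMap_subset {I : Set L} (hI : IsRegularIdeal I) {x : L} :
    canonicalMap x ⊆ I ↔ x ∈ I :=
  ⟨fun h => h (mem_canonicalMap_self x),
    fun hx c hc => hI.regular c fun b hb => hI.lower x b hx (hc b hb)⟩

/-- The regular ideal generated by a set `V`. -/
def regularClosure (V : Set L) : Set L :=
  {x | ∀ y, WellInside y x → ∃ V₀ : Finset L, (V₀ : Set L) ⊆ V ∧ y ≤ V₀.sup id}

theorem subset_regularClosure (V : Set L) : V ⊆ regularClosure V := fun x hx y hy =>
  ⟨{x}, by simpa using hx, by simpa using hy.le⟩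

/-- Normality enters twice: splitting below a join gives closure under joins, and interpolation
gives regularity. -/
theorem IsNormalLattice.isRegularIdeal_regularClosure (hL : IsNormalLattice L) (V : Set L) :
    IsRegularIdeal (regularClosure V) where
  bot_mem y hy := ⟨∅, by simp, hy.le⟩
  lower x y hx h z hz := hx z (hz.trans_le h)
  sup_mem x y hx hy z hz := by
    classical
    obtain ⟨w, w', hw, hw', hz⟩ := hL.exists_of_wellInside_sup hz
    obtain ⟨V₁, hV₁, h₁⟩ := hx w hw
    obtain ⟨V₂, hV₂, h₂⟩ := hy w' hw'
    refine ⟨V₁ ∪ V₂, by simpa using ⟨hV₁, hV₂⟩, ?_⟩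
    rw [Finset.sup_union]
    exact hz.trans (sup_le_sup h₁ h₂)
  regular x h y hy := by
    obtain ⟨w, hyw, hwx⟩ := hL.exists_between hy
    exact h w hwx y hyw

theorem IsRegularIdeal.regularClosure_subset {I : Set L} (hI : IsRegularIdeal I) {V : Set L} :
    regularClosure V ⊆ I ↔ V ⊆ I := by
  refine ⟨(subset_regularClosure V).trans, fun hV x hx => hI.regular x fun y hy => ?_⟩
  obtain ⟨V₀, hV₀, h⟩ := hx y hy
  exact hI.lower _ _ (hI.finset_sup_mem V₀ (hV₀.trans hV)) h

/-- The regular closure is the least regular ideal containing `V`, so it is the decisive test for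
the quantifier over `I`. -/
theorem IsNormalLattice.covers_iff (hL : IsNormalLattice L) {x : L} {V : Set L} :
    Covers x V ↔ x ∈ regularClosure V := by
  refine ⟨fun h => ?_, fun hx I hI h => ?_⟩
  · have hI := hL.isRegularIdeal_regularClosure V
    exact hI.canonicalMap_subset.1
      (h _ hI fun v hv => hI.canonicalMap_subset.2 (subset_regularClosure V hv))
  · exact hI.canonicalMap_subset.2
      (hI.regularClosure_subset.2 (fun v hv => hI.canonicalMap_subset.1 (h v hv)) hx)

theorem IsNormalLattice.forall_covers_iff (hL : IsNormalLattice L) {U : Set L} :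
    (∀ x, Covers x U → x ∈ U) ↔ IsRegularIdeal U := by
  refine ⟨fun h => ?_, fun h x hx => h.regularClosure_subset.2 subset_rfl (hL.covers_iff.1 hx)⟩
  have : regularClosure U = U :=
    Set.Subset.antisymm (fun x hx => h x (hL.covers_iff.2 hx)) (subset_regularClosure U)
  exact this ▸ hL.isRegularIdeal_regularClosure U

/-- The frame law for regular ideals. -/
theorem IsRegularIdeal.inter_regularClosure_subset {I J V : Set L} (hI : IsRegularIdeal I)
    (hJ : IsRegularIdeal J) (h : I ∩ V ⊆ J)
    (hV : ∀ v ∈ V, ∀ w ≤ v, w ∈ V) : I ∩ regularClosure V ⊆ J := by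
  rintro x ⟨hxI, hxV⟩
  refine hJ.regular x fun y hy => ?_
  obtain ⟨V₀, hV₀, hyV⟩ := hxV y hy
  -- Now `y` is the finite join of the `y ⊓ v`; each lies in `I`, being below `x`, and in `V`, being
  -- below `v`.
  rw [← inf_eq_left.2 hyV, Finset.sup_inf_distrib_left]
  refine Finset.sup_induction (p := (· ∈ J)) hJ.bot_mem (fun _ hx _ hy => hJ.sup_mem _ _ hx hy)
    fun v hv => h ⟨hI.lower _ _ hxI (inf_le_left.trans hy.le), hV v (hV₀ hv) _ inf_le_right⟩

/-- Through this identity the evident compatibility of `f` with meets shows that principal regular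
ideals respect meets. -/
theorem canonicalMap_eq_regularClosure (x : L) : canonicalMap x = regularClosure {x} := by
  ext c
  refine forall₂_congr fun y _ => ⟨fun h => ⟨{x}, by simp, by simpa using h⟩, ?_⟩
  rintro ⟨V₀, hV₀, h⟩
  exact h.trans (Finset.sup_le fun v hv => (hV₀ hv : v = x).le)

theorem canonicalMap_inf (x y : L) :
    canonicalMap (x ⊓ y) = canonicalMap x ∩ canonicalMap y := by
  ext c
  simp only [canonicalMap, le_inf_iff, Set.mem_ofPred_eq, Set.mem_inter_iff]
  exact ⟨fun h => ⟨fun b hb => (h b hb).1, fun b hb => (h b hb).2⟩,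
    fun h b hb => ⟨h.1 b hb, h.2 b hb⟩⟩

/-- A homomorphism `f` is proper if everything well inside `f x` lies below some `f w` with `w`
well inside `x`. -/
def IsProperHom {M : Type*} [DistribLattice M] [BoundedOrder M] (f : BoundedLatticeHom L M) :
    Prop :=
  ∀ (x : L) (y : M), WellInside y (f x) → ∃ w, WellInside w x ∧ y ≤ f w

/-- Properness replaces an arbitrary `y ≪ f x` by some `f w` with `w ≪ x`, where the finite cover is
known. Stability of generated ideals under restriction follows. -/
theorem IsProperHom.map_mem_regularClosure {M : Type*} [DistribLattice M] [BoundedOrder M]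
    {f : BoundedLatticeHom L M} (hf : IsProperHom f) {V : Set L} {W : Set M}
    (h : ∀ v ∈ V, f v ∈ W) {x : L} (hx : x ∈ regularClosure V) : f x ∈ regularClosure W := by
  classical
  intro y hy
  obtain ⟨w, hw, hyw⟩ := hf x y hy
  obtain ⟨V₀, hV₀, hwV⟩ := hx w hw
  refine ⟨V₀.image f, by simpa [Set.subset_def] using fun v hv => h v (hV₀ hv), hyw.trans ?_⟩
  rw [Finset.sup_image]
  refine (OrderHomClass.mono f hwV).trans (le_of_eq ?_)
  rw [map_finset_sup]
  rfl

end Normal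

/-! ### The internal frame of regular ideals -/

section RegSub

variable {P : Type u} [PartialOrder P]

/-- A functor with values in normal lattices whose transition maps are proper. -/
class IsNormalDiagram (L : P ⥤ BddDistLat.{u}) : Prop where
  normal : ∀ C, IsNormalLattice (L.obj C)
  proper : ∀ (C D : P) (h : C ≤ D), IsProperHom (res L h)

theorem res_refl (F : P ⥤ BddDistLat.{u}) {C : P} (x : F.obj C) : res F le_rfl x = x := by
  have : F.map (homOfLE (le_refl C)) = 𝟙 _ := F.map_id C
  simp only [res, this]
  rfl

theorem naturality_res {F G : P ⥤ BddDistLat.{u}} (φ : F ⟶ G) {C D : P} (h : C ≤ D)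
    (x : F.obj C) : (φ.app D).hom (res F h x) = res G h ((φ.app C).hom x) :=
  congrArg (fun f => f.hom x) (φ.naturality (homOfLE h))

/-- The subfunctors of `L|↑C` whose values are regular ideals. -/
def RegSub (L : P ⥤ BddDistLat.{u}) (C : P) : Type u :=
  {U : SubAbove (underlying L) C // ∀ (D : P) (h : C ≤ D), IsRegularIdeal (L := L.obj D) (U.at D h)}

namespace RegSub

variable {L : P ⥤ BddDistLat.{u}} {C : P}

instance : PartialOrder (RegSub L C) := inferInstanceAs (PartialOrder (Subtype _))

/-- The value at `D ≥ C`. -/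
def val (U : RegSub L C) (D : P) (h : C ≤ D) : Set (L.obj D) := U.1.at D h

theorem isRegularIdeal (U : RegSub L C) (D : P) (h : C ≤ D) : IsRegularIdeal (U.val D h) := U.2 D h

theorem res_mem (U : RegSub L C) {D E : P} (h : C ≤ D) (k : D ≤ E) {x : L.obj D}
    (hx : x ∈ U.val D h) : res L k x ∈ U.val E (h.trans k) :=
  U.1.map (U := ⟨D, h⟩) (V := ⟨E, h.trans k⟩) (homOfLE k) hx

theorem le_iff {U V : RegSub L C} : U ≤ V ↔ ∀ D h, U.val D h ⊆ V.val D h :=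
  ⟨fun h D k => h ⟨D, k⟩, fun h D => h D.1 D.2⟩

/-- A stable family of regular ideals. -/
def ofFamily (S : ∀ D, C ≤ D → Set (L.obj D))
    (hS : ∀ D h E (k : D ≤ E), ∀ x ∈ S D h, res L k x ∈ S E (h.trans k))
    (hreg : ∀ D h, IsRegularIdeal (S D h)) : RegSub L C :=
  ⟨{ obj := fun D => S D.1 D.2
     map := fun {D E} i x hx => hS D.1 D.2 E.1 i.le x hx }, hreg⟩

@[ext]
theorem ext {U V : RegSub L C} (h : ∀ D h, U.val D h = V.val D h) : U = V :=
  le_antisymm (le_iff.2 fun D k => (h D k).subset) (le_iff.2 fun D k => (h D k).superset)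

/-- Truncation to `↑D`. -/
def truncate {D : P} (h : C ≤ D) (U : RegSub L C) : RegSub L D :=
  ofFamily (fun E k => U.val E (h.trans k)) (fun _ k _ l _ hx => U.res_mem (h.trans k) l hx)
    fun E k => U.isRegularIdeal E (h.trans k)

instance : Top (RegSub L C) :=
  ⟨ofFamily (fun _ _ => Set.univ) (fun _ _ _ _ _ _ => trivial) fun _ _ => isRegularIdeal_univ⟩

instance : Min (RegSub L C) :=
  ⟨fun U V => ofFamily (fun D h => U.val D h ∩ V.val D h)
    (fun _ h _ k _ hx => ⟨U.res_mem h k hx.1, V.res_mem h k hx.2⟩)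
    fun D h => (U.isRegularIdeal D h).inter (V.isRegularIdeal D h)⟩

variable [hL : IsNormalDiagram L]

/-- The stable family of regular ideals generated by a stable family of subsets. -/
def closure (S : ∀ D, C ≤ D → Set (L.obj D))
    (hS : ∀ D h E (k : D ≤ E), ∀ x ∈ S D h, res L k x ∈ S E (h.trans k)) : RegSub L C :=
  ofFamily (fun D h => regularClosure (S D h))
    (fun D h E k _ hx => (hL.proper D E k).map_mem_regularClosure (hS D h E k) hx)
    fun D h => (hL.normal D).isRegularIdeal_regularClosure (S D h)

theorem closure_le_iff {S : ∀ D, C ≤ D → Set (L.obj D)} {hS} {U : RegSub L C} :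
    closure S hS ≤ U ↔ ∀ D h, S D h ⊆ U.val D h :=
  le_iff.trans (forall₂_congr fun D h => (U.isRegularIdeal D h).regularClosure_subset)

instance : Bot (RegSub L C) := ⟨closure (fun _ _ => ∅) fun _ _ _ _ _ h => h.elim⟩

instance : Max (RegSub L C) :=
  ⟨fun U V => closure (fun D h => U.val D h ∪ V.val D h)
    fun _ h _ k _ hx => hx.imp (U.res_mem h k) (V.res_mem h k)⟩

instance : Lattice (RegSub L C) where
  sup := max
  inf := min
  le_sup_left _ _ := le_iff.2 fun _ _ => Set.subset_union_left.trans (subset_regularClosure _)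
  le_sup_right _ _ := le_iff.2 fun _ _ => Set.subset_union_right.trans (subset_regularClosure _)
  sup_le _ _ _ h k := closure_le_iff.2 fun D l => Set.union_subset (le_iff.1 h D l) (le_iff.1 k D l)
  inf_le_left _ _ := le_iff.2 fun _ _ => Set.inter_subset_left
  inf_le_right _ _ := le_iff.2 fun _ _ => Set.inter_subset_right
  le_inf _ _ _ h k := le_iff.2 fun D l => Set.subset_inter (le_iff.1 h D l) (le_iff.1 k D l)

instance : DistribLattice (RegSub L C) :=
  DistribLattice.ofInfSupLe fun U V W => le_iff.2 fun D h => by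
    refine (U.isRegularIdeal D h).inter_regularClosure_subset
      ((U ⊓ V ⊔ U ⊓ W).isRegularIdeal D h) ?_ ?_
    · rw [Set.inter_union_distrib_left]
      exact subset_regularClosure _
    · rintro v (hv | hv) w hw
      · exact Or.inl ((V.isRegularIdeal D h).lower _ _ hv hw)
      · exact Or.inr ((W.isRegularIdeal D h).lower _ _ hv hw)

instance : BoundedOrder (RegSub L C) where
  le_top _ := le_iff.2 fun _ _ => Set.subset_univ _
  bot_le _ := closure_le_iff.2 fun _ _ => Set.empty_subset _

variable (L C) in
/-- Truncation as a lattice homomorphism. -/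
def truncateHom {D : P} (h : C ≤ D) : BoundedLatticeHom (RegSub L C) (RegSub L D) where
  toFun := truncate h
  map_sup' _ _ := rfl
  map_inf' _ _ := rfl
  map_top' := rfl
  map_bot' := rfl

end RegSub

variable (L : P ⥤ BddDistLat.{u}) [hL : IsNormalDiagram L]

/-- The internal lattice of regular ideals of `L`. -/
def regFunctor : P ⥤ BddDistLat.{u} where
  obj C := BddDistLat.of (RegSub L C)
  map {C _} i := BddDistLat.ofHom (RegSub.truncateHom L C i.le)
  map_id _ := rfl
  map_comp _ _ := rfl

variable {L}

theorem res_regFunctor {C D : P} (h : C ≤ D) (U : RegSub L C) :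
    res (regFunctor L) h U = U.truncate h := rfl

/-- Members of a subfunctor of an internal lattice are stable under restriction. -/
theorem SubAbove.res_mem {F : P ⥤ BddDistLat.{u}} {C : P} (U : SubAbove (underlying F) C) {D E : P}
    (h : C ≤ D) (k : D ≤ E) {x : F.obj D} (hx : x ∈ U.at D h) :
    res F k x ∈ U.at E (h.trans k) :=
  U.map (U := ⟨D, h⟩) (V := ⟨E, h.trans k⟩) (homOfLE k) hx

theorem IsInternalSup.restrict {F : P ⥤ BddDistLat.{u}} {C D : P} (h : C ≤ D)
    {U : SubAbove (underlying F) C} {s : F.obj C} (hs : IsInternalSup F U s) :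
    IsInternalSup F (U.truncate h) (res F h s) := fun E hE z => by
  rw [← res_trans]
  exact hs E (h.trans hE) z

theorem IsInternalSup.le_iff {F : P ⥤ BddDistLat.{u}} {C : P}
    {U : SubAbove (underlying F) C} {s : F.obj C} (hs : IsInternalSup F U s) {z : F.obj C} :
    s ≤ z ↔ ∀ (E : P) (hE : C ≤ E) (y : F.obj E), y ∈ U.at E hE → y ≤ res F hE z := by
  simpa only [res_refl] using hs C le_rfl z

theorem IsInternalSup.unique {F : P ⥤ BddDistLat.{u}} {C : P}
    {U : SubAbove (underlying F) C} {s t : F.obj C} (hs : IsInternalSup F U s)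
    (ht : IsInternalSup F U t) : s = t :=
  le_antisymm (hs.le_iff.2 (ht.le_iff.1 le_rfl)) (ht.le_iff.2 (hs.le_iff.1 le_rfl))

/-- The union of an internal family of regular ideals. -/
def unionFamily {C : P} (S : SubAbove (underlying (regFunctor L)) C) (D : P) (h : C ≤ D) :
    Set (L.obj D) :=
  {x | ∃ U : RegSub L D, U ∈ S.at D h ∧ x ∈ U.val D le_rfl}

theorem res_mem_unionFamily {C : P} (S : SubAbove (underlying (regFunctor L)) C) (D : P)
    (h : C ≤ D) (E : P) (k : D ≤ E) (x) (hx : x ∈ unionFamily S D h) :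
    res L k x ∈ unionFamily S E (h.trans k) := by
  obtain ⟨U, hU, hx⟩ := hx
  exact ⟨U.truncate k, S.res_mem h k hU, U.res_mem le_rfl k hx⟩

/-- The join of an internal family of regular ideals. -/
def familySup {C : P} (S : SubAbove (underlying (regFunctor L)) C) : RegSub L C :=
  RegSub.closure (unionFamily S) (res_mem_unionFamily S)

/-- A member of `S` at `E` is a subfunctor on all of `↑E`, but its truncations are again members.
Looking only at base stages, as `unionFamily` does, therefore loses nothing. -/
theorem isInternalSup_familySup {C : P} (S : SubAbove (underlying (regFunctor L)) C) :
    IsInternalSup (regFunctor L) S (familySup S) := by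
  intro D hD (z : RegSub L D)
  refine (RegSub.closure_le_iff (hS := fun E h => res_mem_unionFamily S E (hD.trans h))).trans
    ⟨fun h E hE (y : RegSub L E) hy => RegSub.le_iff.2 fun E' hE' x hx =>
      h E' (hE.trans hE') ⟨y.truncate hE', S.res_mem _ hE' hy, hx⟩, ?_⟩
  rintro h E hE x ⟨y, hy, hx⟩
  exact RegSub.le_iff.1 (h E hE y hy) E le_rfl hx

/-- Uniqueness reduces to the explicit join; at each stage distributivity is the frame law for
regular ideals, applied to the lower set of elements of members. -/
theorem isInternalFrame_regFunctor : IsInternalFrame (regFunctor L) where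
  exists_sup _ S := ⟨_, isInternalSup_familySup S⟩
  inf_sup C (x : RegSub L C) s S hs := by
    obtain rfl := hs.unique (isInternalSup_familySup S)
    intro D hD (z : RegSub L D)
    constructor
    · rintro h E hE _ ⟨y : RegSub L E, hy, rfl⟩
      have hy' : y ≤ res (regFunctor L) (hD.trans hE) (familySup S) :=
        ((isInternalSup_familySup S) E (hD.trans hE) _).1 le_rfl E le_rfl y hy |>.trans
          (res_refl (regFunctor L) _).le
      exact (inf_le_inf_left (x.truncate (hD.trans hE)) hy').trans
        (RegSub.le_iff.2 fun E' k => RegSub.le_iff.1 h E' (hE.trans k))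
    · intro h
      refine RegSub.le_iff.2 fun E hE => ?_
      refine (x.isRegularIdeal E (hD.trans hE)).inter_regularClosure_subset
        (z.isRegularIdeal E hE) ?_ ?_
      · rintro w ⟨hwx, U, hU, hwU⟩
        exact RegSub.le_iff.1 (h E hE (x.truncate (hD.trans hE) ⊓ U) ⟨U, hU, rfl⟩) E le_rfl ⟨hwx, hwU⟩
      · rintro v ⟨U, hU, hv⟩ w hw
        exact ⟨U, hU, (U.isRegularIdeal E le_rfl).lower _ _ hv hw⟩

end RegSub

/-! ### The universal property of the internal frame of regular ideals. -/

section Universal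

variable {P : Type u} [PartialOrder P] {L : P ⥤ BddDistLat.{u}}

/-- A natural transformation is regular if `φ x` lies below each upper bound of the elements `φ y`,
`y ≪ x`. -/
def IsRegularTransformation {G : P ⥤ BddDistLat.{u}} (φ : L ⟶ G) : Prop :=
  ∀ (C : P) (x : L.obj C) (z : G.obj C),
    (∀ y, WellInside y x → (φ.app C).hom y ≤ z) → (φ.app C).hom x ≤ z

theorem isInternalSup_imageSub_iff {F G : P ⥤ BddDistLat.{u}} {φ : F ⟶ G} {C : P}
    {U : SubAbove (underlying F) C} {s : G.obj C} :
    IsInternalSup G (imageSub φ U) s ↔ ∀ (D : P) (hD : C ≤ D) (z : G.obj D), res G hD s ≤ z ↔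
      ∀ (E : P) (hE : D ≤ E) (x : F.obj E), x ∈ U.at E (hD.trans hE) →
        (φ.app E).hom x ≤ res G hE z := by
  refine forall₃_congr fun D hD z => iff_congr Iff.rfl ⟨fun h E hE x hx => h E hE _ ⟨x, hx, rfl⟩, ?_⟩
  rintro h E hE _ ⟨x, hx, rfl⟩
  exact h E hE x hx

theorem IsInternalFrameMap.comp {F G H : P ⥤ BddDistLat.{u}} {φ : F ⟶ G} {ψ : G ⟶ H}
    (hφ : IsInternalFrameMap φ) (hψ : IsInternalFrameMap ψ) : IsInternalFrameMap (φ ≫ ψ) := by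
  intro C U s hs
  refine isInternalSup_imageSub_iff.2 fun D hD z =>
    (isInternalSup_imageSub_iff.1 (hψ C _ _ (hφ C U s hs)) D hD z).trans
      ⟨fun h E hE x hx => h E hE _ ⟨x, hx, rfl⟩, ?_⟩
  rintro h E hE _ ⟨x, hx, rfl⟩
  exact h E hE x hx

theorem isInternalFrameMap_id (F : P ⥤ BddDistLat.{u}) : IsInternalFrameMap (𝟙 F) :=
  fun _ _ _ hs => isInternalSup_imageSub_iff.2 hs

variable [hL : IsNormalDiagram L]

variable (L) in
/-- The map sending `x` to the principal regular ideal it generates. -/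
def principal : L ⟶ regFunctor L where
  app C := BddDistLat.ofHom
    { toFun := fun x => RegSub.closure (fun _ h => {res L h x}) (by
        rintro D h E k _ rfl
        exact (res_trans L h k x).symm)
      map_sup' := fun x y => by
        refine le_antisymm (RegSub.closure_le_iff.2 ?_) (sup_le ?_ ?_)
        · rintro D h _ rfl
          rw [map_sup]
          exact (RegSub.isRegularIdeal _ D h).sup_mem _ _
            (subset_regularClosure _ (Or.inl (subset_regularClosure _ rfl)))
            (subset_regularClosure _ (Or.inr (subset_regularClosure _ rfl)))
        · refine RegSub.closure_le_iff.2 ?_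
          rintro D h _ rfl
          exact (RegSub.isRegularIdeal _ D h).lower _ _ (subset_regularClosure _ rfl)
            (OrderHomClass.mono (res L h) le_sup_left)
        · refine RegSub.closure_le_iff.2 ?_
          rintro D h _ rfl
          exact (RegSub.isRegularIdeal _ D h).lower _ _ (subset_regularClosure _ rfl)
            (OrderHomClass.mono (res L h) le_sup_right)
      map_inf' := fun x y => by
        refine RegSub.ext fun D h => ?_
        change regularClosure {res L h (x ⊓ y)} =
          regularClosure {res L h x} ∩ regularClosure {res L h y}
        rw [← canonicalMap_eq_regularClosure, map_inf, canonicalMap_inf,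
          canonicalMap_eq_regularClosure, canonicalMap_eq_regularClosure]
      map_top' := by
        refine top_le_iff.1 (RegSub.le_iff.2 fun D h x _ => ?_)
        exact (RegSub.isRegularIdeal _ D h).lower _ _ (subset_regularClosure _ rfl)
          (le_top.trans (map_top (res L h)).ge)
      map_bot' := by
        refine le_bot_iff.1 (RegSub.closure_le_iff.2 ?_)
        rintro D h _ rfl
        rw [map_bot]
        exact (RegSub.isRegularIdeal _ D h).bot_mem }
  naturality C D i := by
    apply BddDistLat.hom_ext
    ext x
    refine RegSub.ext fun E h => ?_
    exact congrArg (fun y : L.obj E => regularClosure {y}) (res_trans L i.le h x).symm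

/-- The principal regular ideal generated by `x`. -/
abbrev principalSub {C : P} (x : L.obj C) : RegSub L C := ((principal L).app C).hom x

theorem principalSub_le_iff {C : P} {x : L.obj C} {U : RegSub L C} :
    principalSub x ≤ U ↔ x ∈ U.val C le_rfl := by
  refine RegSub.closure_le_iff.trans ⟨fun h => h C le_rfl (res_refl L x).symm, ?_⟩
  rintro h D k _ rfl
  exact U.res_mem le_rfl k h

/-- Since the principal ideal of `x` lies below `z` iff `x ∈ z`, this is the regularity of the value
of `z` at `C`. -/
theorem isRegularTransformation_principal : IsRegularTransformation (principal L) :=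
  fun C _ z h => principalSub_le_iff.2
    ((z.isRegularIdeal C le_rfl).regular _ fun y hy => principalSub_le_iff.1 (h y hy))

/-- The subfunctor underlying a member of `RegSub L C`. -/
abbrev RegSub.toSub {C : P} (U : RegSub L C) : SubAbove (underlying L) C := U.1

/-- Each member of the frame is the internal join of its principal members. -/
theorem isInternalSup_principal {C : P} (U : RegSub L C) :
    IsInternalSup (regFunctor L) (imageSub (principal L) U.toSub) U := by
  refine isInternalSup_imageSub_iff.2 fun D hD (z : RegSub L D) => ?_
  refine (RegSub.le_iff (U := U.truncate hD)).trans (forall₂_congr fun E hE => ?_)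
  exact forall₂_congr fun x _ => (principalSub_le_iff (U := z.truncate hE)).symm

variable {G : P ⥤ BddDistLat.{u}} {φ : L ⟶ G} (hφ : IsRegularTransformation φ)

/-- The right adjoint of the extension of `φ` to the frame of regular ideals. -/
def coextension {C : P} (z : G.obj C) : RegSub L C :=
  RegSub.ofFamily (fun D h => {x | (φ.app D).hom x ≤ res G h z})
    (fun D h E k x (hx : _ ≤ _) => by
      change (φ.app E).hom _ ≤ _
      rw [naturality_res, res_trans G h k]
      exact OrderHomClass.mono (res G k) hx)
    fun D h =>
      { bot_mem := (map_bot (φ.app D).hom).le.trans bot_le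
        lower := fun x y hx hy => (OrderHomClass.mono (φ.app D).hom hy).trans hx
        sup_mem := fun x y hx hy => (map_sup (φ.app D).hom x y).le.trans (sup_le hx hy)
        regular := fun x hx => hφ D x _ hx }

omit hL in
theorem coextension_truncate {C D : P} (h : C ≤ D) (z : G.obj C) :
    (coextension hφ z).truncate h = coextension hφ (res G h z) :=
  RegSub.ext fun E k => by
    ext x
    change _ ≤ _ ↔ _ ≤ _
    rw [res_trans G h k]

variable (hG : IsInternalFrame G)

/-- The join in `G` of the image of a regular ideal. -/
noncomputable def extensionFun {C : P} (U : RegSub L C) : G.obj C :=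
  (hG.exists_sup C (imageSub φ U.toSub)).choose

omit hL in
theorem isInternalSup_extensionFun {C : P} (U : RegSub L C) :
    IsInternalSup G (imageSub φ U.toSub) (extensionFun (φ := φ) hG U) :=
  (hG.exists_sup C (imageSub φ U.toSub)).choose_spec

-- This adjunction supplies the preservation of joins; only meets need the frame law of `G`.
omit hL in
theorem extensionFun_le_iff {C : P} {U : RegSub L C} {z : G.obj C} :
    extensionFun (φ := φ) hG U ≤ z ↔ U ≤ coextension hφ z := by
  rw [(isInternalSup_extensionFun hG U).le_iff, RegSub.le_iff]
  refine ⟨fun h E hE x hx => h E hE _ ⟨x, hx, rfl⟩, ?_⟩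
  rintro h E hE _ ⟨x, hx, rfl⟩
  exact h E hE hx

-- The suprema are chosen separately at each stage; their uniqueness makes the choice natural.
omit hL in
theorem res_extensionFun {C D : P} (h : C ≤ D) (U : RegSub L C) :
    res G h (extensionFun (φ := φ) hG U) = extensionFun (φ := φ) hG (U.truncate h) :=
  ((isInternalSup_extensionFun hG U).restrict h).unique
    (isInternalSup_extensionFun hG (U.truncate h))

omit hL in
theorem le_extensionFun {C : P} {U : RegSub L C} {x : L.obj C} (hx : x ∈ U.val C le_rfl) :
    (φ.app C).hom x ≤ extensionFun (φ := φ) hG U := by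
  have := (isInternalSup_extensionFun (φ := φ) hG U).le_iff.1 le_rfl C le_rfl _ ⟨x, hx, rfl⟩
  rwa [res_refl] at this

omit hL in
theorem gc_extensionFun {C : P} :
    GaloisConnection (extensionFun (C := C) (φ := φ) hG) (coextension hφ) :=
  fun _ _ => extensionFun_le_iff hφ hG

omit hL in
theorem inf_extensionFun_le_iff {C : P} {U : RegSub L C} {y z : G.obj C} :
    y ⊓ extensionFun (φ := φ) hG U ≤ z ↔ ∀ (E : P) (hE : C ≤ E) (x : L.obj E), x ∈ U.val E hE →
      res G hE y ⊓ (φ.app E).hom x ≤ res G hE z := by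
  rw [(hG.inf_sup C y _ _ (isInternalSup_extensionFun hG U)).le_iff]
  refine ⟨fun h E hE x hx => h E hE _ ⟨_, ⟨x, hx, rfl⟩, rfl⟩, ?_⟩
  rintro h E hE _ ⟨_, ⟨x, hx, rfl⟩, rfl⟩
  exact h E hE x hx

-- The frame law of `G`, used once for each factor, reduces to `φ v ⊓ φ w` with `v` from `V` and `w`
-- from `U` at a common later stage; there `v ⊓ w` lies in both ideals.
include hφ in
theorem extensionFun_inf {C : P} (U V : RegSub L C) :
    extensionFun (φ := φ) hG (U ⊓ V) =
      extensionFun (φ := φ) hG U ⊓ extensionFun (φ := φ) hG V := by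
  refine le_antisymm ((gc_extensionFun hφ hG).monotone_l.map_inf_le U V) ?_
  refine (inf_extensionFun_le_iff hG).2 fun E hE v hv => ?_
  rw [res_extensionFun, res_extensionFun, inf_comm]
  refine (inf_extensionFun_le_iff hG).2 fun E' hE' w hw => ?_
  rw [res_extensionFun, ← naturality_res, ← map_inf]
  refine le_extensionFun hG ⟨?_, ?_⟩
  · exact (U.isRegularIdeal E' _).lower _ _ hw inf_le_right
  · exact (V.isRegularIdeal E' _).lower _ _ (V.res_mem hE hE' hv) inf_le_left

/-- The extension of a regular transformation to the frame of regular ideals. -/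
noncomputable def extension : regFunctor L ⟶ G where
  app C := BddDistLat.ofHom
    { toFun := extensionFun (φ := φ) hG
      map_sup' := fun U V => (gc_extensionFun hφ hG).l_sup
      map_inf' := extensionFun_inf hφ hG
      map_top' := top_le_iff.1 ((map_top (φ.app C).hom).ge.trans (le_extensionFun hG trivial))
      map_bot' := (gc_extensionFun hφ hG).l_bot }
  naturality C D i := by
    apply BddDistLat.hom_ext
    ext U
    exact (res_extensionFun hG i.le U).symm

/-- A left adjoint preserves internal suprema because its right adjoint commutes with restriction.
-/
theorem isInternalFrameMap_extension : IsInternalFrameMap (extension hφ hG) := by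
  intro C S s hs
  refine isInternalSup_imageSub_iff.2 fun D hD z => ?_
  rw [← naturality_res]
  refine (extensionFun_le_iff hφ hG).trans
    ((hs D hD (coextension hφ z)).trans (forall₄_congr fun E hE y _ => ?_))
  rw [res_regFunctor, coextension_truncate]
  exact (extensionFun_le_iff hφ hG).symm

theorem principal_extension : principal L ≫ extension hφ hG = φ := by
  apply NatTrans.ext
  funext C
  apply BddDistLat.hom_ext
  ext x
  refine le_antisymm ((extensionFun_le_iff hφ hG).2 (principalSub_le_iff.2 ?_))
    (le_extensionFun hG (principalSub_le_iff.1 le_rfl))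
  exact (res_refl G _).ge

/-- Every `U` is the internal join of its principal members, so a frame map is determined on these.
-/
theorem eq_extension {ψ : regFunctor L ⟶ G} (hψ : IsInternalFrameMap ψ)
    (h : principal L ≫ ψ = φ) : ψ = extension hφ hG := by
  subst h
  apply NatTrans.ext
  funext C
  apply BddDistLat.hom_ext
  ext U
  refine (hψ C _ _ (isInternalSup_principal U)).unique ?_
  refine isInternalSup_imageSub_iff.2 fun D hD z => ?_
  refine (isInternalSup_imageSub_iff.1 (isInternalSup_extensionFun hG U) D hD z).trans ?_
  constructor
  · rintro h E hE _ ⟨x, hx, rfl⟩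
    exact h E hE x hx
  · exact fun h E hE x hx => h E hE _ ⟨x, hx, rfl⟩

end Universal

/-! ### The spectral lattice of a ring of continuous functions -/

namespace SpectralRelations

variable {R L : Type*} [CommRing R] [DistribLattice L] [BoundedOrder L] {D : R → L}
  (hD : SpectralRelations D)
include hD

theorem map_zero : D 0 = ⊥ := by simpa using hD.map_neg_sq 0

/-- Adding `-b²` back costs nothing, as `D (-b²) = ⊥`. As nonnegative functions are squares, this
yields monotonicity of `D`. -/
theorem map_add_sq_le (a b : R) : D a ≤ D (a + b * b) := by
  have := hD.map_add (a + b * b) (-(b * b))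
  rwa [hD.map_neg_sq, sup_bot_eq, add_neg_cancel_right] at this

theorem inf_eq_bot_of_mul_eq_zero {a b : R} (h : a * b = 0) : D a ⊓ D b = ⊥ := by
  refine le_bot_iff.1 ?_
  rw [← hD.map_zero, ← h, hD.map_mul]
  exact le_sup_left

theorem inf_le_map_mul (a b : R) : D a ⊓ D b ≤ D (a * b) := by
  rw [hD.map_mul]
  exact le_sup_left

theorem le_map_pow (a : R) (n : ℕ) : D a ≤ D (a ^ n) := by
  induction n with
  | zero => simp [hD.map_one]
  | succ n ih =>
    rw [pow_succ]
    exact (le_inf ih le_rfl).trans (hD.inf_le_map_mul _ _)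

theorem map_nsmul_le (n : ℕ) (a : R) : D (n • a) ≤ D a := by
  induction n with
  | zero => simp [hD.map_zero]
  | succ n ih =>
    rw [succ_nsmul]
    exact (hD.map_add _ _).trans (sup_le ih le_rfl)

end SpectralRelations

namespace SpecLattice

variable {X : Type u} [TopologicalSpace X]

theorem exists_mul_self_eq {f : C(X, ℝ)} (hf : 0 ≤ f) : ∃ g, g * g = f :=
  ⟨⟨fun x => √(f x), by fun_prop⟩, ContinuousMap.ext fun x => Real.mul_self_sqrt (hf x)⟩

theorem D_mono : Monotone (D : C(X, ℝ) → SpecLattice C(X, ℝ)) := fun a b h => by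
  obtain ⟨g, hg⟩ := exists_mul_self_eq (sub_nonneg.2 h)
  simpa [hg] using spectralRelations_D.map_add_sq_le a g

/-- The functions `a ⊔ b - a` and `a ⊔ b - b` have product zero, hence disjoint symbols.
Subadditivity bounds `D (a ⊔ b)` by `D a ⊔ D b` joined with either symbol, and distributivity
removes both. -/
theorem D_sup (a b : C(X, ℝ)) : D (a ⊔ b) = D a ⊔ D b := by
  refine le_antisymm ?_ (sup_le (D_mono le_sup_left) (D_mono le_sup_right))
  have h₀ : D ((a ⊔ b) - a) ⊓ D ((a ⊔ b) - b) = ⊥ := by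
    refine spectralRelations_D.inf_eq_bot_of_mul_eq_zero (ContinuousMap.ext fun x => ?_)
    rcases le_total (a x) (b x) with h | h <;> simp [h]
  have h₁ := spectralRelations_D.map_add a ((a ⊔ b) - a)
  have h₂ := spectralRelations_D.map_add b ((a ⊔ b) - b)
  rw [add_sub_cancel] at h₁ h₂
  calc D (a ⊔ b) ≤ ((D a ⊔ D b) ⊔ D ((a ⊔ b) - a)) ⊓ ((D a ⊔ D b) ⊔ D ((a ⊔ b) - b)) :=
        le_inf (h₁.trans (sup_le_sup_right le_sup_left _))
          (h₂.trans (sup_le_sup_right le_sup_right _))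
    _ = D a ⊔ D b := by rw [← sup_inf_left, h₀, sup_bot_eq]

theorem D_inf (a b : C(X, ℝ)) : D (a ⊓ b) = D a ⊓ D b := by
  refine le_antisymm (le_inf (D_mono inf_le_left) (D_mono inf_le_right)) ?_
  have h₀ : D (a - a ⊓ b) ⊓ D (b - a ⊓ b) = ⊥ := by
    refine spectralRelations_D.inf_eq_bot_of_mul_eq_zero (ContinuousMap.ext fun x => ?_)
    rcases le_total (a x) (b x) with h | h <;> simp [h]
  have h₁ := spectralRelations_D.map_add (a ⊓ b) (a - a ⊓ b)
  have h₂ := spectralRelations_D.map_add (a ⊓ b) (b - a ⊓ b)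
  rw [add_sub_cancel] at h₁ h₂
  calc D a ⊓ D b ≤ (D (a ⊓ b) ⊔ D (a - a ⊓ b)) ⊓ (D (a ⊓ b) ⊔ D (b - a ⊓ b)) :=
        inf_le_inf h₁ h₂
    _ = D (a ⊓ b) := by rw [← sup_inf_left, h₀, sup_bot_eq]

theorem D_surjective_continuousMap :
    Function.Surjective (D : C(X, ℝ) → SpecLattice C(X, ℝ)) := by
  intro x
  obtain ⟨t, rfl⟩ := mk_surjective x
  induction t with
  | gen a => exact ⟨a, rfl⟩
  | top => exact ⟨1, spectralRelations_D.map_one⟩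
  | bot => exact ⟨0, spectralRelations_D.map_zero⟩
  | inf x y hx hy =>
    obtain ⟨a, ha⟩ := hx
    obtain ⟨b, hb⟩ := hy
    exact ⟨a ⊓ b, by rw [D_inf, ha, hb]; rfl⟩
  | sup x y hx hy =>
    obtain ⟨a, ha⟩ := hx
    obtain ⟨b, hb⟩ := hy
    exact ⟨a ⊔ b, by rw [D_sup, ha, hb]; rfl⟩

/-- Each point is a truth-valued model of the relations; together they detect `⊥` and `⊤`. -/
theorem spectralRelations_eval (x : X) :
    SpectralRelations fun f : C(X, ℝ) => 0 < f x where
  map_one := by simp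
  map_inf_neg a := by
    simp only [ContinuousMap.neg_apply, Left.neg_pos_iff, inf_Prop_eq, Prop.bot_eq_false,
      eq_iff_iff, iff_false, not_and, not_lt]
    exact fun h => h.le
  map_neg_sq b := by
    simp only [ContinuousMap.neg_apply, ContinuousMap.mul_apply, Prop.bot_eq_false, eq_iff_iff,
      iff_false, not_lt]
    nlinarith [mul_self_nonneg (b x)]
  map_add a b h := by
    by_contra! hc
    simp only [sup_Prop_eq, not_or, not_lt, ContinuousMap.add_apply] at hc h
    linarith [hc.1, hc.2]
  map_mul a b := by simp [mul_pos_iff]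

/-- Evaluation at a point. -/
def evalHom (x : X) : BoundedLatticeHom (SpecLattice C(X, ℝ)) Prop :=
  lift _ (spectralRelations_eval x)

theorem D_eq_bot_iff {f : C(X, ℝ)} : D f = ⊥ ↔ f ≤ 0 := by
  refine ⟨fun h x => ?_, fun h => le_bot_iff.1 ?_⟩
  · have : (0 < f x) = ⊥ := (congrArg (evalHom x) h).trans (map_bot _)
    simpa using this
  · rw [← spectralRelations_D.map_zero]
    exact D_mono h

theorem D_eq_top_iff {f : C(X, ℝ)} : D f = ⊤ ↔ ∀ x, 0 < f x := by
  refine ⟨fun h x => ?_, fun h => ?_⟩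
  · have : (0 < f x) = ⊤ := (congrArg (evalHom x) h).trans (map_top _)
    simpa using this
  · let g : C(X, ℝ) := ⟨fun x => (f x)⁻¹, f.continuous.inv₀ fun x => (h x).ne'⟩
    have hfg : f * g = 1 := ContinuousMap.ext fun x => mul_inv_cancel₀ (h x).ne'
    have hf : D (-f) = ⊥ := D_eq_bot_iff.2 fun x => neg_nonpos.2 (h x).le
    rw [← top_le_iff, ← spectralRelations_D.map_one, ← hfg, spectralRelations_D.map_mul, hf,
      bot_inf_eq, sup_bot_eq]
    exact inf_le_left

/-- By compactness `a ⊔ b` has a positive lower bound `ε`, and any rational `q` in `(0, ε)` works.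
This is the source of normality. -/
theorem exists_D_sub_sup_eq_top [CompactSpace X] {a b : C(X, ℝ)} (h : D a ⊔ D b = ⊤) :
    ∃ q : ℚ, 0 < q ∧ D (a - ContinuousMap.const X (q : ℝ)) ⊔ D b = ⊤ := by
  rw [← D_sup, D_eq_top_iff] at h
  obtain ⟨ε, hε, hab⟩ : ∃ ε : ℝ, 0 < ε ∧ ∀ x, ε ≤ (a ⊔ b) x := by
    rcases isEmpty_or_nonempty X with hX | hX
    · exact ⟨1, one_pos, fun x => hX.elim x⟩
    · obtain ⟨x, -, hx⟩ := isCompact_univ.exists_isMinOn (Set.univ_nonempty (α := X))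
        (a ⊔ b).continuous.continuousOn
      exact ⟨_, h x, fun y => hx (Set.mem_univ y)⟩
  obtain ⟨q, hq, hqε⟩ := exists_rat_btwn hε
  refine ⟨q, by exact_mod_cast hq, ?_⟩
  rw [← D_sup, D_eq_top_iff]
  intro x
  have := hab x
  simp only [ContinuousMap.sup_apply, ContinuousMap.sub_apply, ContinuousMap.const_apply,
    lt_sup_iff, le_sup_iff] at this ⊢
  exact this.imp (fun h => by linarith) fun h => by linarith

theorem D_eq_bot_of_forall_sub {a : C(X, ℝ)}
    (h : ∀ q : ℚ, 0 < q → D (a - ContinuousMap.const X (q : ℝ)) = ⊥) : D a = ⊥ := by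
  refine D_eq_bot_iff.2 fun x => ?_
  change a x ≤ 0
  by_contra hx
  obtain ⟨q, hq, hqx⟩ := exists_rat_btwn (not_le.1 hx)
  have : a x - q ≤ 0 := D_eq_bot_iff.1 (h q (by exact_mod_cast hq)) x
  linarith

/-! #### Comparison with the prime spectrum -/

/-- The quotient `u² / h` is bounded by `h`, so it extends continuously by `0` across the zeros of
`h`; the square is what provides this bound. -/
theorem dvd_sq_of_le {u h : C(X, ℝ)} (hu : 0 ≤ u) (huh : u ≤ h) : h ∣ u ^ 2 := by
  have h₀ (x : X) : 0 ≤ u x := hu x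
  have h₁ (x : X) : u x ≤ h x := huh x
  refine ⟨⟨fun x => u x ^ 2 / h x, continuous_iff_continuousAt.2 fun x => ?_⟩, ?_⟩
  · rcases eq_or_ne (h x) 0 with hx | hx
    · have hb (y : X) : |u y ^ 2 / h y| ≤ h y := by
        rw [abs_of_nonneg (div_nonneg (sq_nonneg _) ((h₀ y).trans (h₁ y)))]
        refine div_le_of_le_mul₀ ((h₀ y).trans (h₁ y)) ((h₀ y).trans (h₁ y)) ?_
        nlinarith [h₀ y, h₁ y]
      have hh : Filter.Tendsto h (nhds x) (nhds 0) := hx ▸ h.continuous.tendsto x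
      rw [ContinuousAt, hx, div_zero]
      exact squeeze_zero_norm hb hh
    · exact ((u.continuous.pow 2).continuousAt).div h.continuous.continuousAt hx
  · ext x
    rcases eq_or_ne (h x) 0 with hx | hx
    · have : u x = 0 := le_antisymm ((h₁ x).trans hx.le) (h₀ x)
      simp [this]
    · simp [mul_div_cancel₀ _ hx]

theorem mem_of_le {p : Ideal C(X, ℝ)} (hp : p.IsPrime) {u h : C(X, ℝ)} (hu : 0 ≤ u) (huh : u ≤ h)
    (hh : h ∈ p) : u ∈ p :=
  hp.mem_of_pow_mem 2 (p.mem_of_dvd (dvd_sq_of_le hu huh) hh)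

/-- A model finer than the points: evaluations only compare the sets `{a > 0}`, while basic opens
remember divisibility up to powers. Convexity of prime ideals (`mem_of_le`) replaces inequalities by
membership. -/
theorem spectralRelations_basicOpen :
    SpectralRelations fun f : C(X, ℝ) => PrimeSpectrum.basicOpen (f ⊔ 0) where
  map_one := by
    rw [sup_eq_left.2 zero_le_one, PrimeSpectrum.basicOpen_one]
  map_inf_neg a := by
    rw [← PrimeSpectrum.basicOpen_mul]
    convert PrimeSpectrum.basicOpen_zero
    ext x
    rcases le_total (a x) 0 with h | h <;> simp [h]
  map_neg_sq b := by
    convert PrimeSpectrum.basicOpen_zero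
    ext x
    simpa using mul_self_nonneg (b x)
  map_add a b p hp := by
    by_contra hc
    have hc' : a ⊔ 0 ∈ p.asIdeal ∧ b ⊔ 0 ∈ p.asIdeal := by
      simpa [PrimeSpectrum.mem_basicOpen] using hc
    refine hp (mem_of_le p.2 le_sup_right (sup_le ?_ ?_) (p.asIdeal.add_mem hc'.1 hc'.2))
    · exact add_le_add le_sup_left le_sup_left
    · exact add_nonneg le_sup_right le_sup_right
  map_mul a b := by
    have key : (a * b) ⊔ 0 = (a ⊔ 0) * (b ⊔ 0) + (-a ⊔ 0) * (-b ⊔ 0) := by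
      ext x
      rcases le_total (a x) 0 with h | h <;> rcases le_total (b x) 0 with k | k <;>
        simp [h, k, mul_nonneg, mul_nonneg_of_nonpos_of_nonpos, mul_nonpos_of_nonneg_of_nonpos,
          mul_nonpos_of_nonpos_of_nonneg]
    have h₁ : 0 ≤ (a ⊔ 0) * (b ⊔ 0) := mul_nonneg le_sup_right le_sup_right
    have h₂ : 0 ≤ (-a ⊔ 0) * (-b ⊔ 0) := mul_nonneg le_sup_right le_sup_right
    rw [key, ← PrimeSpectrum.basicOpen_mul, ← PrimeSpectrum.basicOpen_mul]
    refine le_antisymm (fun p hp => ?_) (sup_le (fun p hp => ?_) fun p hp => ?_)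
    · by_contra hc
      have hc' : (a ⊔ 0) * (b ⊔ 0) ∈ p.asIdeal ∧ (-a ⊔ 0) * (-b ⊔ 0) ∈ p.asIdeal := by
        simpa only [TopologicalSpace.Opens.mem_sup, PrimeSpectrum.mem_basicOpen, not_or,
          not_not] using hc
      exact hp (p.asIdeal.add_mem hc'.1 hc'.2)
    · exact fun h => hp (mem_of_le p.2 h₁ (le_add_of_nonneg_right h₂) h)
    · exact fun h => hp (mem_of_le p.2 h₂ (le_add_of_nonneg_left h₁) h)

/-- Inclusion of basic opens says that a power of `a⁺` is a multiple `c b⁺`; compactness bounds `c`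
by a natural number `m`. -/
theorem D_le_D_iff [CompactSpace X] {a b : C(X, ℝ)} :
    D a ≤ D b ↔ ∃ n m : ℕ, (a ⊔ 0) ^ n ≤ m • (b ⊔ 0) := by
  have hb (c : C(X, ℝ)) : D (c ⊔ 0) = D c := by
    rw [D_sup, spectralRelations_D.map_zero, sup_bot_eq]
  constructor
  · intro h
    have := OrderHomClass.mono (lift _ spectralRelations_basicOpen) h
    rw [lift_D, lift_D, PrimeSpectrum.basicOpen_le_basicOpen_iff] at this
    obtain ⟨n, hn⟩ := this
    obtain ⟨c, hc⟩ := Ideal.mem_span_singleton'.1 hn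
    obtain ⟨m, hm⟩ := exists_nat_ge ‖c‖
    refine ⟨n, m, fun x => ?_⟩
    rw [← hc]
    have := (le_abs_self _).trans ((c.norm_coe_le_norm x).trans hm)
    simpa using mul_le_mul_of_nonneg_right this (le_sup_right : (0 : ℝ) ≤ b x ⊔ 0)
  · rintro ⟨n, m, h⟩
    rw [← hb a, ← hb b]
    exact (spectralRelations_D.le_map_pow _ n).trans
      ((D_mono h).trans (spectralRelations_D.map_nsmul_le m _))

/-! ### Ring homomorphisms between rings of continuous functions preserve and reflect order. -/

section Hom

variable {Y : Type u} [TopologicalSpace Y] (g : C(X, ℝ) →+* C(Y, ℝ))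

theorem ringHom_nonneg {f : C(X, ℝ)} (hf : 0 ≤ f) : 0 ≤ g f := by
  obtain ⟨h, rfl⟩ := exists_mul_self_eq hf
  rw [map_mul]
  exact fun y => mul_self_nonneg _

/-- The positive part is algebraic: `f⁺` and `f⁺ - f` are nonnegative, that is squares, with product
zero, and this determines `f⁺`. -/
theorem ringHom_sup_zero (f : C(X, ℝ)) : g (f ⊔ 0) = g f ⊔ 0 := by
  have h₁ : 0 ≤ g (f ⊔ 0) := ringHom_nonneg g le_sup_right
  have h₂ : 0 ≤ g (f ⊔ 0 - f) := ringHom_nonneg g (sub_nonneg.2 le_sup_left)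
  have h₃ : g (f ⊔ 0) * g (f ⊔ 0 - f) = 0 := by
    rw [← map_mul, ← map_zero g]
    congr 1
    ext x
    rcases le_total (f x) 0 with h | h <;> simp [h]
  rw [map_sub] at h₂ h₃
  ext y
  have h₁ : 0 ≤ g (f ⊔ 0) y := h₁ y
  have h₂ : 0 ≤ g (f ⊔ 0) y - g f y := h₂ y
  have h₃ : g (f ⊔ 0) y * (g (f ⊔ 0) y - g f y) = 0 := DFunLike.congr_fun h₃ y
  rw [ContinuousMap.sup_apply, ContinuousMap.zero_apply]
  rcases mul_eq_zero.1 h₃ with h | h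
  · rw [h] at h₂ ⊢
    exact (sup_eq_right.2 (by linarith)).symm
  · rw [sub_eq_zero.1 h] at h₁ ⊢
    exact (sup_eq_left.2 h₁).symm

theorem le_of_ringHom_le (hg : Function.Injective g) {a b : C(X, ℝ)} (h : g a ≤ g b) : a ≤ b := by
  have : a - b ≤ 0 := by
    rw [← sup_eq_right]
    apply hg
    rw [ringHom_sup_zero, map_sub, map_zero]
    exact sup_eq_right.2 (sub_nonpos.2 h)
  exact sub_nonpos.1 this

/-- The criterion `(a⁺)^n ≤ m b⁺` uses only ring operations, positive parts and order, all handled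
by an injective ring homomorphism. -/
theorem map_injective_continuousMap [CompactSpace X] [CompactSpace Y] (hg : Function.Injective g) :
    Function.Injective (map g) := by
  have key (a b : C(X, ℝ)) (h : map g (D a) ≤ map g (D b)) : D a ≤ D b := by
    change D (g a) ≤ D (g b) at h
    obtain ⟨n, m, h⟩ := D_le_D_iff.1 h
    refine D_le_D_iff.2 ⟨n, m, le_of_ringHom_le g hg ?_⟩
    rwa [map_pow, map_nsmul, ringHom_sup_zero, ringHom_sup_zero]
  intro x y h
  obtain ⟨a, rfl⟩ := D_surjective_continuousMap x
  obtain ⟨b, rfl⟩ := D_surjective_continuousMap y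
  exact le_antisymm (key a b h.le) (key b a h.ge)

end Hom

end SpecLattice

/-! ### The spectral lattice of the self-adjoint part of a commutative C*-algebra -/

section Gelfand

variable {B : Type u} [CommCStarAlgebra B]

open WeakDual Complex

/-- The Gelfand isomorphism between the self-adjoint part of a commutative C*-algebra and the real
continuous functions on its character space. -/
noncomputable def realGelfand : selfAdjoint B ≃+* C(characterSpace ℂ B, ℝ) where
  toFun a := ⟨fun x => (gelfandStarTransform B a.1 x).re, by fun_prop⟩
  invFun f := ⟨(gelfandStarTransform B).symm ⟨fun x => (f x : ℂ), by fun_prop⟩, by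
    rw [selfAdjoint.mem_iff, ← map_star]
    congr 1
    ext x
    exact Complex.conj_ofReal _⟩
  left_inv a := by
    have ha : star (gelfandStarTransform B a.1) = gelfandStarTransform B a.1 := by
      rw [← map_star, a.2]
    apply Subtype.ext
    change (gelfandStarTransform B).symm _ = a.1
    rw [StarAlgEquiv.symm_apply_eq]
    ext x
    exact Complex.conj_eq_iff_re.1 (DFunLike.congr_fun ha x)
  right_inv f := by
    ext x
    change (gelfandStarTransform B ((gelfandStarTransform B).symm _) x).re = _
    rw [StarAlgEquiv.apply_symm_apply]
    rfl
  map_mul' a b := by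
    have h (c : selfAdjoint B) (x) : (gelfandStarTransform B c.1 x).im = 0 := by
      refine Complex.conj_eq_iff_im.1 (DFunLike.congr_fun
        (show star (gelfandStarTransform B c.1) = gelfandStarTransform B c.1 from ?_) x)
      rw [← map_star, c.2]
    ext x
    simpa using Or.inl (h a x)
  map_add' a b := by
    ext x
    simp

theorem realGelfand_smul_one (r : ℝ) :
    realGelfand (r • (1 : selfAdjoint B)) = ContinuousMap.const _ r := by
  ext x
  change (gelfandStarTransform B (r • (1 : B)) x).re = r
  rw [← Complex.coe_smul, map_smul, map_one]
  simp

end Gelfand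

/-! ### Normality, regular ideals and injectivity, transferred along the Gelfand isomorphism. -/

namespace SpecLattice

section Equiv

variable {R S : Type u} [CommRing R] [CommRing S]

theorem map_D (f : R →+* S) (a : R) : map f (D a) = D (f a) := rfl

theorem map_map_symm (e : R ≃+* S) (x : SpecLattice R) :
    map e.symm.toRingHom (map e.toRingHom x) = x := by
  have : (map e.symm.toRingHom).comp (map e.toRingHom) = BoundedLatticeHom.id _ :=
    hom_ext fun a => by
      change D (e.symm (e a)) = D a
      rw [e.symm_apply_apply]
  exact DFunLike.congr_fun this x

theorem map_equiv_injective (e : R ≃+* S) : Function.Injective (map e.toRingHom) :=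
  Function.LeftInverse.injective (map_map_symm e)

end Equiv

variable {B B' : Type u} [CommCStarAlgebra B] [CommCStarAlgebra B']

theorem D_surjective : Function.Surjective (D : selfAdjoint B → SpecLattice (selfAdjoint B)) := by
  intro x
  obtain ⟨f, hf⟩ := D_surjective_continuousMap (map realGelfand.toRingHom x)
  refine ⟨realGelfand.symm f, map_equiv_injective realGelfand ?_⟩
  rw [← hf, map_D]
  exact congrArg D (realGelfand.apply_symm_apply f)

theorem map_realGelfand_D_sub (a : selfAdjoint B) (q : ℚ) :
    map (realGelfand (B := B)).toRingHom (D (a - (q : ℝ) • (1 : selfAdjoint B))) =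
      D (realGelfand a - ContinuousMap.const _ (q : ℝ)) := by
  rw [← realGelfand_smul_one, ← map_sub]
  rfl

theorem exists_sub_sup_eq_top {a : selfAdjoint B} {z : SpecLattice (selfAdjoint B)}
    (h : D a ⊔ z = ⊤) : ∃ q : ℚ, 0 < q ∧ D (a - (q : ℝ) • (1 : selfAdjoint B)) ⊔ z = ⊤ := by
  obtain ⟨b, rfl⟩ := D_surjective z
  have h' := congrArg (map (realGelfand (B := B)).toRingHom) h
  rw [map_sup, map_top] at h'
  obtain ⟨q, hq, h'⟩ := exists_D_sub_sup_eq_top h'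
  refine ⟨q, hq, map_equiv_injective realGelfand ?_⟩
  rw [map_sup, map_top, map_realGelfand_D_sub]
  exact h'

theorem wellInside_D_sub (a : selfAdjoint B) {q : ℚ} (hq : 0 < q) :
    WellInside (D (a - (q : ℝ) • (1 : selfAdjoint B))) (D a) := by
  -- The witness is `D (q - a)`: since `a + (q - a) = q` is a positive constant, subadditivity gives
  -- the cover.
  refine ⟨D (-(a - (q : ℝ) • (1 : selfAdjoint B))), spectralRelations_D.map_inf_neg _, ?_⟩
  refine top_le_iff.1 (le_trans ?_ (spectralRelations_D.map_add _ _))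
  refine le_of_eq (map_equiv_injective realGelfand ?_)
  rw [map_top, neg_sub, add_sub_cancel]
  change ⊤ = D (realGelfand ((q : ℝ) • (1 : selfAdjoint B)))
  rw [realGelfand_smul_one, eq_comm, D_eq_top_iff]
  exact fun x => Rat.cast_pos.2 hq

/-- Shifts by positive rationals are cofinal among the elements well inside `D a`; this links
regular ideals with the regularity rule. -/
theorem wellInside_D_iff {x : SpecLattice (selfAdjoint B)} {a : selfAdjoint B} :
    WellInside x (D a) ↔ ∃ q : ℚ, 0 < q ∧ x ≤ D (a - (q : ℝ) • (1 : selfAdjoint B)) := by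
  constructor
  · rintro ⟨z, hx, hz⟩
    obtain ⟨q, hq, hqz⟩ := exists_sub_sup_eq_top hz
    exact ⟨q, hq, le_of_inf_eq_bot_of_sup_eq_top hx hqz⟩
  · rintro ⟨q, hq, hx⟩
    obtain ⟨z, hz, hz'⟩ := wellInside_D_sub a hq
    exact ⟨z, le_bot_iff.1 ((inf_le_inf_right z hx).trans hz.le), hz'⟩

theorem isNormalLattice : IsNormalLattice (SpecLattice (selfAdjoint B)) := by
  intro x z h
  obtain ⟨a, rfl⟩ := D_surjective x
  obtain ⟨q, hq, h⟩ := exists_sub_sup_eq_top h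
  exact ⟨_, wellInside_D_sub a hq, h⟩

theorem mem_regularClosure_iff {a : selfAdjoint B} {V : Set (SpecLattice (selfAdjoint B))} :
    D a ∈ regularClosure V ↔ ∀ q : ℚ, 0 < q → ∃ V₀ : Finset (SpecLattice (selfAdjoint B)),
      (V₀ : Set (SpecLattice (selfAdjoint B))) ⊆ V ∧
        D (a - (q : ℝ) • (1 : selfAdjoint B)) ≤ V₀.sup id := by
  refine ⟨fun h q hq => h _ (wellInside_D_sub a hq), fun h y hy => ?_⟩
  obtain ⟨q, hq, hy⟩ := wellInside_D_iff.1 hy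
  obtain ⟨V₀, hV₀, h⟩ := h q hq
  exact ⟨V₀, hV₀, hy.trans h⟩

/-- The Archimedean property: `a ≤ q` for all rational `q > 0` forces `a ≤ 0`. -/
theorem isRegularIdeal_bot : IsRegularIdeal ({⊥} : Set (SpecLattice (selfAdjoint B))) where
  bot_mem := rfl
  lower x y hx h := le_bot_iff.1 (h.trans (le_of_eq hx))
  sup_mem x y hx hy := by
    rw [Set.mem_singleton_iff] at *
    rw [hx, hy, sup_bot_eq]
  regular x h := by
    obtain ⟨a, rfl⟩ := D_surjective x
    refine map_equiv_injective realGelfand ?_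
    rw [map_bot]
    refine D_eq_bot_of_forall_sub fun q hq => ?_
    refine (map_realGelfand_D_sub a q).symm.trans ?_
    exact (congrArg _ (h _ (wellInside_D_sub a hq))).trans (map_bot _)

/-- Because `f` fixes scalars, the cofinal elements `D (f a - q)` are images of the elements `D (a -
q)`. -/
theorem isProperHom_map {f : selfAdjoint B →+* selfAdjoint B'}
    (hf : ∀ r : ℝ, f (r • 1) = r • 1) : IsProperHom (map f) := by
  intro x y hy
  obtain ⟨a, rfl⟩ := D_surjective x
  obtain ⟨q, hq, hy⟩ := wellInside_D_iff.1 hy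
  refine ⟨_, wellInside_D_sub a hq, ?_⟩
  rwa [map_D, map_sub, hf]

theorem map_injective {f : selfAdjoint B →+* selfAdjoint B'} (hf : Function.Injective f) :
    Function.Injective (map f) := by
  let g : C(WeakDual.characterSpace ℂ B, ℝ) →+* C(WeakDual.characterSpace ℂ B', ℝ) :=
    (realGelfand (B := B')).toRingHom.comp (f.comp (realGelfand (B := B)).symm.toRingHom)
  have hg : Function.Injective g :=
    realGelfand.injective.comp (hf.comp realGelfand.symm.injective)
  have h : (map (realGelfand (B := B')).toRingHom).comp (map f) =
      (map g).comp (map (realGelfand (B := B)).toRingHom) := hom_ext fun a => by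
    change D (realGelfand (f a)) = D (realGelfand (f (realGelfand.symm (realGelfand a))))
    rw [RingEquiv.symm_apply_apply]
  have : Function.Injective ((map (realGelfand (B := B')).toRingHom).comp (map f)) := by
    rw [h]
    exact (map_injective_continuousMap g hg).comp (map_equiv_injective realGelfand)
  exact fun x y hxy => this (congrArg (map (realGelfand (B := B')).toRingHom) hxy)

end SpecLattice

/-! ### The external description -/

section External

variable {P : Type u} [PartialOrder P] [OrderBot P] {L F : P ⥤ BddDistLat.{u}}
  (hbot : ∀ C, IsRegularIdeal ({⊥} : Set (L.obj C)))
  (e : ∀ C, F.obj C ≃o RegSub L C)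
  (he : ∀ (C D : P) (h : C ≤ D) (x : F.obj C), e D (res F h x) = (e C x).truncate h)

omit [OrderBot P] in
include he in
theorem section_val {V : AlexandrovOpens P} (s : Sections F V) {C D : P} (h : C ≤ D)
    (hC : Topology.WithUpperSet.toUpperSet C ∈ V) (hD : Topology.WithUpperSet.toUpperSet D ∈ V) :
    (e D (s.1 ⟨D, hD⟩)).val D le_rfl = (e C (s.1 ⟨C, hC⟩)).val D h := by
  rw [← s.2 ⟨C, hC⟩ ⟨D, hD⟩ h, he]
  rfl

omit [OrderBot P] in
theorem mem_of_le_of_mem {V : AlexandrovOpens P} {C D : P} (h : C ≤ D)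
    (hC : Topology.WithUpperSet.toUpperSet C ∈ V) : Topology.WithUpperSet.toUpperSet D ∈ V :=
  V.2 (a := Topology.WithUpperSet.toUpperSet C) h hC

/-- The extension by `{⊥}` of a section over an upper set to a global section. -/
def extendByBot {V : AlexandrovOpens P} (s : Sections F V) : RegSub L ⊥ :=
  RegSub.ofFamily
    (fun E _ => {x | x = ⊥ ∨ ∃ hE : Topology.WithUpperSet.toUpperSet E ∈ V,
      x ∈ (e E (s.1 ⟨E, hE⟩)).val E le_rfl})
    (by
      rintro D - E k x (rfl | ⟨hD, hx⟩)
      · exact Or.inl (map_bot _)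
      · refine Or.inr ⟨mem_of_le_of_mem k hD, ?_⟩
        rw [section_val e he s k hD]
        exact (e D _).res_mem le_rfl k hx)
    (by
      intro D _
      -- Over `V` the value is that of the section, which already contains `⊥`; elsewhere it is
      -- `{⊥}`.
      by_cases hD : Topology.WithUpperSet.toUpperSet D ∈ V
      · have hI := (e D (s.1 ⟨D, hD⟩)).isRegularIdeal D le_rfl
        convert hI
        ext x
        refine ⟨?_, fun hx => Or.inr ⟨hD, hx⟩⟩
        rintro (rfl | ⟨_, hx⟩)
        exacts [hI.bot_mem, hx]
      · convert hbot D
        ext x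
        simp [hD])

theorem extendByBot_le_iff {V : AlexandrovOpens P} (s : Sections F V) (U : RegSub L ⊥) :
    extendByBot hbot e he s ≤ U ↔
      ∀ C : {C : P // Topology.WithUpperSet.toUpperSet C ∈ V},
        e C.1 (s.1 C) ≤ U.truncate bot_le := by
  rw [RegSub.le_iff]
  constructor
  · rintro h ⟨C, hC⟩
    refine RegSub.le_iff.2 fun D hD x hx => h D bot_le (Or.inr ⟨mem_of_le_of_mem hD hC, ?_⟩)
    rwa [section_val e he s hD hC]
  · rintro h D hD x (rfl | ⟨hV, hx⟩)
    · exact (U.isRegularIdeal D hD).bot_mem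
    · exact RegSub.le_iff.1 (h ⟨D, hV⟩) D le_rfl hx

theorem gc_extendByBot (V : AlexandrovOpens P) :
    GaloisConnection (fun s => (e ⊥).symm (extendByBot hbot e he s)) (Sections.ofBot F V) := by
  intro s x
  rw [(e ⊥).symm_apply_le, extendByBot_le_iff]
  refine forall_congr' fun C => ?_
  rw [← he ⊥ C.1 bot_le x, OrderIso.le_iff_le]
  rfl

/-- The external description of an internal frame of regular ideals. -/
def externalDescription (V : AlexandrovOpens P) : F.obj ⊥ :=
  (e ⊥).symm (extendByBot hbot e he (Sections.top F V))

theorem isExternalDescription_externalDescription :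
    IsExternalDescription F (externalDescription hbot e he) :=
  fun V => ⟨_, gc_extendByBot hbot e he V, rfl⟩

variable [IsNormalDiagram L]

/-- Extending the top section gives everything over `V` and `{⊥}` elsewhere, so the frame map laws
become pointwise logic. -/
theorem mem_externalDescription {V : AlexandrovOpens P} {E : P} {x : L.obj E} :
    x ∈ (e ⊥ (externalDescription hbot e he V)).val E bot_le ↔
      x = ⊥ ∨ Topology.WithUpperSet.toUpperSet E ∈ V := by
  rw [externalDescription, OrderIso.apply_symm_apply]
  refine or_congr Iff.rfl ⟨fun h => h.1, fun h => ⟨h, ?_⟩⟩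
  change x ∈ (e E ⊤).val E le_rfl
  rw [map_top]
  trivial

theorem externalDescription_le_iff {V : AlexandrovOpens P} {x : F.obj ⊥} :
    externalDescription hbot e he V ≤ x ↔
      ∀ E, Topology.WithUpperSet.toUpperSet E ∈ V → (e ⊥ x).val E bot_le = Set.univ := by
  rw [← (e ⊥).le_iff_le, RegSub.le_iff]
  constructor
  · exact fun h E hE => Set.eq_univ_of_forall fun y =>
      h E bot_le ((mem_externalDescription hbot e he).2 (Or.inr hE))
  · intro h E hE y hy
    rcases (mem_externalDescription hbot e he).1 hy with rfl | hV
    · exact ((e ⊥ x).isRegularIdeal E hE).bot_mem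
    · exact (h E hV).ge trivial

theorem isFrameMap_externalDescription : IsFrameMap (externalDescription hbot e he) where
  map_top := by
    apply (e ⊥).injective
    rw [map_top]
    refine RegSub.ext fun E _ => Set.eq_univ_of_forall fun x => ?_
    exact (mem_externalDescription hbot e he).2 (Or.inr trivial)
  map_inf V W := by
    apply (e ⊥).injective
    rw [map_inf]
    refine RegSub.ext fun E _ => Set.ext fun x => ?_
    refine (mem_externalDescription hbot e he).trans (Iff.trans ?_ (and_congr
      (mem_externalDescription hbot e he) (mem_externalDescription hbot e he)).symm)
    exact or_and_left
  map_sSup S := by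
    constructor
    · rintro _ ⟨V, hV, rfl⟩
      exact (externalDescription_le_iff hbot e he).2 fun E hE =>
        (externalDescription_le_iff hbot e he).1 le_rfl E (Opens.mem_sSup.2 ⟨V, hV, hE⟩)
    · refine fun x hx => (externalDescription_le_iff hbot e he).2 fun E hE => ?_
      obtain ⟨V, hV, hE⟩ := Opens.mem_sSup.1 hE
      exact (externalDescription_le_iff hbot e he).1 (hx ⟨V, hV, rfl⟩) E hE

end External

/-! ### The spectrum of the Bohrification -/

theorem SpectralRelations.comp {R L M : Type*} [CommRing R] [DistribLattice L] [BoundedOrder L]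
    [DistribLattice M] [BoundedOrder M] {D : R → L} (hD : SpectralRelations D)
    (f : BoundedLatticeHom L M) : SpectralRelations fun a => f (D a) where
  map_one := by rw [hD.map_one, map_top]
  map_inf_neg a := by rw [← map_inf, hD.map_inf_neg, map_bot]
  map_neg_sq b := by rw [hD.map_neg_sq, map_bot]
  map_add a b := by
    rw [← map_sup]
    exact OrderHomClass.mono f (hD.map_add a b)
  map_mul a b := by
    rw [hD.map_mul, map_sup, map_inf, map_inf]

variable {A : Type u} [CStarAlgebra A]

theorem Context.incl_injective {C D : Context A} (h : C ≤ D) :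
    Function.Injective (Context.incl h) := fun _ _ hab =>
  Subtype.ext (Subtype.ext (congrArg (fun c : D.Sa => (c.1 : A)) hab))

instance : IsNormalDiagram (specFunctor A) where
  normal C := SpecLattice.isNormalLattice (B := C.1)
  proper _ _ h := SpecLattice.isProperHom_map (f := Context.incl h) fun _ => rfl

theorem isRegularIdeal_bot_specFunctor (C : Context A) :
    IsRegularIdeal ({⊥} : Set ((specFunctor A).obj C)) :=
  SpecLattice.isRegularIdeal_bot (B := C.1)

theorem val_naturality {F : Context A ⥤ BddDistLat.{u}} (g : bohrSa A ⟶ underlying F)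
    {C D : Context A} (h : C ≤ D) (a : C.Sa) :
    val g (Context.incl h a) = res F h (val g a) :=
  NatTrans.naturality_apply g (homOfLE h) a

/-- The transformation from the free internal lattice given by an arrow satisfying the relations. -/
noncomputable def specLift {M : Context A ⥤ BddDistLat.{u}} (k : bohrSa A ⟶ underlying M)
    (hk : InternalRelations k) : specFunctor A ⟶ M where
  app C := BddDistLat.ofHom (SpecLattice.lift (fun a : C.Sa => val k a) (hk C))
  naturality C D i := by
    apply BddDistLat.hom_ext
    exact SpecLattice.hom_ext fun a => val_naturality k i.le a

theorem specFunctor_hom_ext {M : Context A ⥤ BddDistLat.{u}} {φ ψ : specFunctor A ⟶ M}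
    (h : ∀ (C : Context A) (a : C.Sa),
      (φ.app C).hom (val (specGen A) a) = (ψ.app C).hom (val (specGen A) a)) : φ = ψ := by
  apply NatTrans.ext
  funext C
  apply BddDistLat.hom_ext
  exact SpecLattice.hom_ext (h C)

theorem isFreeInternalLattice_specFunctor : IsFreeInternalLattice (specFunctor A) (specGen A) where
  relations _ := SpecLattice.spectralRelations_D
  existsUnique _ k hk := ⟨specLift k hk, fun _ _ => rfl, fun _ hφ => specFunctor_hom_ext hφ⟩

/-- Every element is some `D a`, and each `D (a - r)` is well inside it, so the regularity rule
suffices. -/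
theorem isRegularTransformation_specLift {M : Context A ⥤ BddDistLat.{u}}
    (k : bohrSa A ⟶ underlying M) (hk : InternalRelations k) (hk' : InternalRegularity k) :
    IsRegularTransformation (specLift k hk) := by
  intro C x z h
  obtain ⟨a, rfl⟩ := SpecLattice.D_surjective (B := C.1) x
  exact hk' C a z fun r hr => h _ (SpecLattice.wellInside_D_sub (B := C.1) a hr)

variable (A) in
/-- The generators of the frame of regular ideals. -/
noncomputable def regGen : bohrSa A ⟶ underlying (regFunctor (specFunctor A)) :=
  specGen A ≫ Functor.whiskerRight (principal (specFunctor A)) (forget BddDistLat)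

/-- Freeness in two stages: the relations give a transformation from the lattice, and regularity
extends it to regular ideals; uniqueness holds at both stages. -/
theorem isInternalSpectrum_regFunctor :
    IsInternalSpectrum (regFunctor (specFunctor A)) (regGen A) where
  isFrame := isInternalFrame_regFunctor
  relations C := (SpecLattice.spectralRelations_D (R := C.Sa)).comp
    ((principal (specFunctor A)).app C).hom
  regularity C a z h := isRegularTransformation_principal C _ z fun y hy => by
    obtain ⟨q, hq, hy⟩ := SpecLattice.wellInside_D_iff.1 hy
    exact (OrderHomClass.mono ((principal (specFunctor A)).app C).hom hy).trans (h q hq)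
  existsUnique G g hG hg hg' := by
    have hφ := isRegularTransformation_specLift g hg hg'
    refine ⟨extension hφ hG, ⟨isInternalFrameMap_extension hφ hG, fun C a => ?_⟩, ?_⟩
    · exact congrArg (fun ψ : specFunctor A ⟶ G => (ψ.app C).hom (val (specGen A) a))
        (principal_extension hφ hG)
    · rintro ψ ⟨hψ, h⟩
      exact eq_extension hφ hG hψ (specFunctor_hom_ext h)

theorem IsInternalSpectrum.hom_eq_id {F : Context A ⥤ BddDistLat.{u}} {d : bohrSa A ⟶ underlying F}
    (h : IsInternalSpectrum F d) {φ : F ⟶ F} (hφ : IsInternalFrameMap φ)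
    (hd : ∀ (C : Context A) (a : C.Sa), (φ.app C).hom (val d a) = val d a) : φ = 𝟙 F :=
  (h.existsUnique F d h.isFrame h.relations h.regularity).unique ⟨hφ, hd⟩
    ⟨isInternalFrameMap_id F, fun _ _ => rfl⟩

/-- Any two internal spectra are isomorphic. -/
theorem IsInternalSpectrum.exists_orderIso {F G : Context A ⥤ BddDistLat.{u}}
    {d : bohrSa A ⟶ underlying F} {g : bohrSa A ⟶ underlying G} (hF : IsInternalSpectrum F d)
    (hG : IsInternalSpectrum G g) :
    ∃ e : ∀ C, F.obj C ≃o G.obj C, (∀ (C : Context A) (a : C.Sa), e C (val d a) = val g a) ∧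
      ∀ (C D : Context A) (h : C ≤ D) (x : F.obj C), e D (res F h x) = res G h (e C x) := by
  obtain ⟨φ, ⟨hφ, hφd⟩, -⟩ := hF.existsUnique G g hG.isFrame hG.relations hG.regularity
  obtain ⟨ψ, ⟨hψ, hψg⟩, -⟩ := hG.existsUnique F d hF.isFrame hF.relations hF.regularity
  have h₁ : φ ≫ ψ = 𝟙 F := hF.hom_eq_id (hφ.comp hψ) fun C a =>
    (congrArg (ψ.app C).hom (hφd C a)).trans (hψg C a)
  have h₂ : ψ ≫ φ = 𝟙 G := hG.hom_eq_id (hψ.comp hφ) fun C a =>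
    (congrArg (φ.app C).hom (hψg C a)).trans (hφd C a)
  have h₁' (C) (x : F.obj C) : (ψ.app C).hom ((φ.app C).hom x) = x :=
    congrArg (fun χ : F ⟶ F => (χ.app C).hom x) h₁
  have h₂' (C) (x : G.obj C) : (φ.app C).hom ((ψ.app C).hom x) = x :=
    congrArg (fun χ : G ⟶ G => (χ.app C).hom x) h₂
  refine ⟨fun C => ⟨⟨(φ.app C).hom, (ψ.app C).hom, h₁' C, h₂' C⟩, fun {x y} => ⟨fun h => ?_, ?_⟩⟩,
    hφd, fun C D h x => naturality_res φ h x⟩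
  · have := OrderHomClass.mono (ψ.app C).hom h
    exact (h₁' C x).ge.trans (this.trans (h₁' C y).le)
  · exact fun h => OrderHomClass.mono (φ.app C).hom h

theorem isClosedSub_iff {C : Context A} {U : SubAbove (underlying (specFunctor A)) C} :
    IsClosedSub U ↔ ∀ (D : Context A) (h : C ≤ D),
      IsRegularIdeal (L := SpecLattice D.Sa) (U.at D h) :=
  forall₂_congr fun D _ => (SpecLattice.isNormalLattice (B := D.1)).forall_covers_iff

/-- The closed subfunctors are those with regular ideals as values. -/
def regSubIso (C : Context A) : RegSub (specFunctor A) C ≃o ClosedSub A C where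
  toFun U := ⟨U.1, isClosedSub_iff.2 U.2⟩
  invFun U := ⟨U.1, isClosedSub_iff.1 U.2⟩
  left_inv _ := rfl
  right_inv _ := rfl
  map_rel_iff' := Iff.rfl

/-- The closed subfunctors of `L|↑⊥` and those of `L`. -/
def globalIso : ClosedSub A (⊥ : Context A) ≃o GlobalClosedSub A where
  toFun U := ⟨{ obj := fun C => U.1.at C bot_le
                map := fun {C D} i => U.1.map (U := ⟨C, Set.mem_Ici.2 bot_le⟩)
                  (V := ⟨D, Set.mem_Ici.2 bot_le⟩) (homOfLE i.le) },
    fun C => U.2 C bot_le⟩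
  invFun U := ⟨{ obj := fun C => U.1.obj C.1
                 map := fun {C D} i => U.1.map (U := C.1) (V := D.1) (homOfLE i.le) },
    fun C _ => U.2 C⟩
  left_inv _ := rfl
  right_inv _ := rfl
  map_rel_iff' := ⟨fun h C => h C.1, fun h C => h ⟨C, Set.mem_Ici.2 bot_le⟩⟩

theorem exists_subfunctor_iff (S : ∀ C : Context A, Set (SpecLattice C.Sa)) :
    (∃ U : Subfunctor (underlying (specFunctor A)), ∀ C, U.obj C = S C) ↔
      ∀ (C D : Context A) (h : C ≤ D), res (specFunctor A) h '' S C ⊆ S D := by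
  constructor
  · rintro ⟨U, hU⟩ C D h _ ⟨x, hx, rfl⟩
    exact (hU D).subset (U.map (homOfLE h) ((hU C).superset hx))
  · exact fun h => ⟨⟨S, fun {C D} i x hx => h C D i.le ⟨x, hx, rfl⟩⟩, fun _ => rfl⟩

end Bohrification

/-! ### The theorem, for an arbitrary spectrum. -/

open Bohrification in
theorem theoremA13 {A : Type u} [CStarAlgebra A] :
    -- `C ↦ L_C` is the internal lattice of the spectrum, every element of `L_C` is some `D_c`, and
    -- the maps `L_C → L_D` are injective
    IsFreeInternalLattice (specFunctor A) (specGen A) ∧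
    (∀ C : Context A, Function.Surjective (SpecLattice.D : C.Sa → SpecLattice C.Sa)) ∧
    (∀ (C D : Context A) (h : C ≤ D), Function.Injective (res (specFunctor A) h)) ∧
    -- the covering relation of `L_C` in explicit terms
    (∀ (C : Context A) (c : C.Sa) (V : Set (SpecLattice C.Sa)),
      Covers (SpecLattice.D c) V ↔ ∀ q : ℚ, 0 < q → ∃ V₀ : Finset (SpecLattice C.Sa),
        (V₀ : Set (SpecLattice C.Sa)) ⊆ V ∧
          SpecLattice.D (c - (q : ℝ) • (1 : C.Sa)) ≤ V₀.sup id) ∧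
    -- the closedness condition says that each `U(D)` is a regular ideal
    (∀ (C : Context A) (U : SubAbove (underlying (specFunctor A)) C),
      IsClosedSub U ↔ ∀ (D : Context A) (h : C ≤ D),
        IsRegularIdeal (L := SpecLattice D.Sa) (U.at D h)) ∧
    -- the condition that a family of subsets be a subfunctor
    (∀ S : ∀ C : Context A, Set (SpecLattice C.Sa),
      (∃ U : Subfunctor (underlying (specFunctor A)), ∀ C, U.obj C = S C) ↔
        ∀ (C D : Context A) (h : C ≤ D), res (specFunctor A) h '' S C ⊆ S D) ∧
    -- the spectrum exists, and it is computed by the closed subfunctors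
    (∃ (F : Context A ⥤ BddDistLat.{u}) (d : bohrSa A ⟶ underlying F), IsInternalSpectrum F d) ∧
    ∀ (F : Context A ⥤ BddDistLat.{u}) (d : bohrSa A ⟶ underlying F), IsInternalSpectrum F d →
      ∃ e : ∀ C : Context A, F.obj C ≃o ClosedSub A C,
        -- the generator `D_c` corresponds to the closed subfunctor generated by `D_c`
        (∀ (C : Context A) (c : C.Sa) (D : Context A) (h : C ≤ D),
          (e C (val d c)).1.at D h =
            {x : SpecLattice D.Sa | Covers x {SpecLattice.D (Context.incl h c)}}) ∧
        -- the functorial maps are truncations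
        (∀ (C D : Context A) (h : C ≤ D) (x : F.obj C),
          (e D (res F h x)).1 = (e C x).1.truncate h) ∧
        -- the value at `ℂ · 1` and the external description
        ∃ e₀ : F.obj ⊥ ≃o GlobalClosedSub A,
          (∀ (x : F.obj ⊥) (C : Context A), (e₀ x).1.obj C = (e ⊥ x).1.at C bot_le) ∧
          ∃ π : AlexandrovOpens (Context A) → F.obj ⊥,
            IsExternalDescription F π ∧ IsFrameMap π ∧
            ∀ D E : Context A,
              (D ≤ E → (e₀ (π (upOpen D))).1.obj E = (Set.univ : Set (SpecLattice E.Sa))) ∧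
              (¬ D ≤ E → (e₀ (π (upOpen D))).1.obj E = ({⊥} : Set (SpecLattice E.Sa))) := by
  have hN (C : Context A) := SpecLattice.isNormalLattice (B := C.1)
  refine ⟨isFreeInternalLattice_specFunctor, fun C => SpecLattice.D_surjective (B := C.1),
    fun C D h => SpecLattice.map_injective (B := C.1) (B' := D.1) (Context.incl_injective h),
    fun C c V => (hN C).covers_iff.trans SpecLattice.mem_regularClosure_iff,
    fun C U => isClosedSub_iff, exists_subfunctor_iff,
    ⟨_, _, isInternalSpectrum_regFunctor⟩, fun F d hF => ?_⟩
  -- Universality identifies the given spectrum with the frame of regular ideals, compatibly with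
  -- generators and restriction.
  obtain ⟨e, hed, he⟩ := hF.exists_orderIso isInternalSpectrum_regFunctor
  refine ⟨fun C => (e C).trans (regSubIso C), fun C c D h => ?_, fun C D h x => ?_,
    ((e ⊥).trans (regSubIso ⊥)).trans globalIso, fun x C => rfl,
    externalDescription isRegularIdeal_bot_specFunctor e he,
    isExternalDescription_externalDescription _ e he,
    isFrameMap_externalDescription _ e he, fun D E => ?_⟩
  · ext x
    refine Iff.trans ?_ (hN D).covers_iff.symm
    change x ∈ RegSub.val (e C (val d c)) D h ↔ _
    rw [hed]
    rfl
  · exact congrArg Subtype.val (he C D h x)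
  · have key (x : SpecLattice E.Sa) := mem_externalDescription (V := upOpen D) (E := E) (x := x)
      isRegularIdeal_bot_specFunctor e he
    refine ⟨fun h => Set.eq_univ_of_forall fun x => (key x).2 (Or.inr h), fun h => ?_⟩
    ext x
    exact (key x).trans (or_iff_left h)
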